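/- Let $k$ be a field of characteristic zero, let $R$ be an integral domain which is a finitely generated $k$-algebra, with fraction field $K$, and let $V=\mathrm{Spec}(R)$. Let $L\subset \mathrm{Der}_k(K,K)$ be a $K$-linear subspace closed under the Lie bracket (a singular foliation) with $K$-basis $\delta_1,\dots,\delta_r$. For a fractional ideal $J$ of $R$ let $\mathcal J(J)\subset K$ be the fractional ideal of $R$ generated by the determinants of all $(r+1)\times(r+1)$ matrices with rows $(f_i,\delta_1f_i,\dots,\delta_rf_i)$, $i=0,\dots,r$, where $f_0,\dots,f_r\in J$. For $J\neq 0$ let $\mathrm{Bl}_J(V)=\mathrm{Proj}\bigoplus_{n\ge 0}J^n$, an integral scheme over $V$ with function field $K$. For an integral scheme $X$ over $V$ with function field $K$, say that $L$ is nonsingular on $X$ if for every nonempty affine open $U\subset X$ the image of $\Omega_{\mathcal O(U)/k}\to \widehat L=\mathrm{Hom}_K(L,K)$, $dx\mapsto(\delta\mapsto\delta(x))$, is a projective $\mathcal O(U)$-module. The Gauss blowup of $X$ along $L$ is the blowup of $X$ along the rank one sheaf $\mathrm{Image}(\wedge^r\Omega_{X/k}\to\wedge^r\widehat L)$, where $\wedge^r\widehat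 L\cong K$. (i) For every fractional ideal $J$ of $R$ one has $\mathcal J(J)^{r+2}\subset\mathcal J(J\mathcal J(J))$. (ii) Let $J\ne0$. If $L$ is nonsingular on $\mathrm{Bl}_J(V)$, then there is an integer $N\ge 0$ such that $$J^N\mathcal J(J)^{r+2}=J^N\mathcal J(J\mathcal J(J)).\qquad(*)$$ (iii) Conversely, let $J\neq0$ and suppose that $(*)$ holds for some $N\ge 0$. Then $L$ is nonsingular on $\mathrm{Bl}_{J\mathcal J(J)}(V)$, and $\mathrm{Bl}_{J\mathcal J(J)}(V)$ is, as a scheme over $V$, the Gauss blowup of $\mathrm{Bl}_J(V)$ along $L$. -/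

import Mathlib

open AlgebraicGeometry CategoryTheory

universe u v

noncomputable section

/-! ### Singular foliations and reduced differentials -/

/-- A singular foliation on a variety over `k` with function field `K`: a `K`-linear subspace of
`Der_k(K, K)` which is closed under the Lie bracket. -/
structure SingularFoliation (k : Type v) (K : Type u) [Field k] [Field K] [Algebra k K] where
  /-- The underlying `K`-subspace of `Der_k(K, K)`. -/
  space : Submodule K (Derivation k K K)
  lie_mem : ∀ δ ∈ space, ∀ ε ∈ space, ⁅δ, ε⁆ ∈ space

section Differentials

variable {k : Type v} {K : Type u} [Field k] [Field K] [Algebra k K]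

/-- The derivation `A → Hom_K(L, K)`, `x ↦ (δ ↦ δ x)`, for a `k`-subalgebra `A` of `K`. -/
def SingularFoliation.dbar (L : SingularFoliation k K) (A : Subalgebra k K) :
    Derivation k A (Module.Dual K L.space) where
  toFun x :=
    { toFun := fun δ => δ.1 (x : K)
      map_add' := fun _ _ => rfl
      map_smul' := fun _ _ => rfl }
  map_add' x y := by ext δ; simp
  map_smul' c x := by ext δ; simp
  map_one_eq_zero' := by ext δ; simp
  leibniz' x y := by
    ext δ
    simp [Subalgebra.smul_def]

/-- The reduced differentials: the image of `Ω_{A/k} → Hom_K(L, K)`. -/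
def SingularFoliation.reducedDifferentials (L : SingularFoliation k K) (A : Subalgebra k K) :
    Submodule A (Module.Dual K L.space) :=
  LinearMap.range (L.dbar A).liftKaehlerDifferential

/-- The image of `⋀^r Ω_{A/k} → ⋀^r Hom_K(L, K)`, viewed as an `A`-submodule of `K` through the
isomorphism `⋀^r Hom_K(L, K) ≅ K`, `ω₁ ∧ ⋯ ∧ ω_r ↦ det (ω_i(δ_j))`, which is given by the `K`-basis
`δ₁, …, δ_r` of `L`. -/
def SingularFoliation.topReducedDifferentials (L : SingularFoliation k K) {r : ℕ}
    (δ : Module.Basis (Fin r) K L.space) (A : Subalgebra k K) : Submodule A K :=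
  Submodule.span A
    (Set.range fun ω : Fin r → L.reducedDifferentials A =>
      (Matrix.of fun i j => (ω i : Module.Dual K L.space) (δ j)).det)

end Differentials

/-! ### The operator `𝒥` -/

section J

variable {k : Type v} {R K : Type u} [Field k] [Field K] [Algebra k K] [CommRing R] [Algebra R K]

/-- The matrix with rows `(f_i, δ₁ f_i, …, δ_r f_i)`, `i = 0, …, r`. -/
def SingularFoliation.rowMatrix (L : SingularFoliation k K) {r : ℕ}
    (δ : Module.Basis (Fin r) K L.space) (f : Fin (r + 1) → K) :
    Matrix (Fin (r + 1)) (Fin (r + 1)) K :=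
  Matrix.of fun i => Fin.cons (f i) fun j => (δ j).1 (f i)

/-- `𝒥(J)`: the `R`-submodule of `K` generated by the determinants of the matrices with rows
`(f_i, δ₁ f_i, …, δ_r f_i)`, for `f₀, …, f_r ∈ J`. -/
def SingularFoliation.jac (L : SingularFoliation k K) {r : ℕ}
    (δ : Module.Basis (Fin r) K L.space) (J : Submodule R K) : Submodule R K :=
  Submodule.span R (Set.range fun f : Fin (r + 1) → J => (L.rowMatrix δ fun i => (f i : K)).det)

/-- If `J ≠ 0` then `𝒥(J) ≠ 0`. -/
lemma SingularFoliation.jac_ne_bot [IsDomain R] [IsFractionRing R K]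
    (L : SingularFoliation k K) {r : ℕ} (δ : Module.Basis (Fin r) K L.space)
    {J : Submodule R K} (hJ : J ≠ ⊥) : L.jac δ J ≠ ⊥ := by
  let ρ : K → (Fin (r + 1) → K) := fun x => Fin.cons x fun j => (δ j).1 x
  have hspan : Submodule.span K (ρ '' (J : Set K)) = ⊤ := by
    by_contra hne
    obtain ⟨φ, hφ0, hφ⟩ := Submodule.exists_le_ker_of_lt_top _ (lt_top_iff_ne_top.mpr hne)
    apply hφ0
    let c : Fin (r + 1) → K := fun i => φ (Pi.single i 1)
    have hφc : ∀ v, φ v = ∑ i, v i * c i := fun v => by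
      conv_lhs => rw [pi_eq_sum_univ' v]
      simp [c]
    let D : L.space := ∑ j, c j.succ • δ j
    have hD : ∀ x, D.1 x = ∑ j : Fin r, (δ j).1 x * c j.succ := fun x => by
      change (L.space.subtype D) x = _
      rw [map_sum, ← Derivation.coeFnAddMonoidHom_apply, map_sum, Finset.sum_apply]
      simp [mul_comm]
    have h1 : ∀ x ∈ J, x * c 0 + D.1 x = 0 := fun x hx => by
      have := hφ (Submodule.subset_span ⟨x, hx, rfl⟩)
      rw [LinearMap.mem_ker, hφc, Fin.sum_univ_succ] at this
      rw [hD]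
      simpa [ρ] using this
    obtain ⟨f, hf, hf0⟩ := Submodule.exists_mem_ne_zero_of_ne_bot hJ
    have h2 : ∀ a : R, D.1 (algebraMap R K a) = 0 := fun a => by
      have e1 := h1 f hf
      have e2 := h1 _ (J.smul_mem a hf)
      rw [Algebra.smul_def, Derivation.leibniz, smul_eq_mul, smul_eq_mul] at e2
      have : f * D.1 (algebraMap R K a) = 0 := by
        linear_combination e2 - algebraMap R K a * e1
      exact (mul_eq_zero.mp this).resolve_left hf0
    have h3 : ∀ x, D.1 x = 0 := fun x => by
      obtain ⟨a, b, hb, rfl⟩ := IsFractionRing.div_surjective (A := R) x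
      have hb0 : algebraMap R K b ≠ 0 := IsFractionRing.to_map_ne_zero_of_mem_nonZeroDivisors hb
      have e := h2 a
      rw [← div_mul_cancel₀ (algebraMap R K a) hb0, Derivation.leibniz, h2 b] at e
      simpa [hb0] using e
    have hD0 : D = 0 := Subtype.ext (Derivation.ext h3)
    have hc : ∀ j : Fin r, c j.succ = 0 :=
      Fintype.linearIndependent_iff.mp δ.linearIndependent _ hD0
    have hc0 : c 0 = 0 := by
      have e := h1 f hf
      rw [h3, add_zero] at e
      exact (mul_eq_zero.mp e).resolve_left hf0
    ext i
    refine Fin.cases ?_ (fun j => ?_) i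
    · simpa [c] using hc0
    · simpa [c] using hc j
  let b := Module.Basis.ofSpan hspan.ge
  have : Fintype _ := FiniteDimensional.fintypeBasisIndex b
  let e := Fintype.equivFinOfCardEq (by
    rw [← Module.finrank_eq_card_basis b, Module.finrank_fin_fun] : Fintype.card _ = r + 1)
  let b' := b.reindex e
  have hb' : ∀ i, ∃ x : J, ρ x = b' i := fun i => by
    obtain ⟨x, hx, h⟩ := Module.Basis.ofSpan_subset hspan.ge (Set.mem_range_self (e.symm i))
    exact ⟨⟨x, hx⟩, by rw [h, Module.Basis.reindex_apply]⟩
  choose f hf using hb'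
  intro h0
  have hdet : (L.rowMatrix δ fun i => (f i : K)).det = 0 := by
    rw [← Submodule.mem_bot R, ← h0]
    exact Submodule.subset_span ⟨f, rfl⟩
  have hli : LinearIndependent K (L.rowMatrix δ fun i => (f i : K)).row := by
    convert! b'.linearIndependent using 1
    exact funext hf
  rw [Matrix.linearIndependent_rows_iff_isUnit, Matrix.isUnit_iff_isUnit_det, hdet] at hli
  exact not_isUnit_zero hli

end J

/-! ### Blowups -/

section Rees

variable {R K : Type u} [CommRing R] [Field K] [Algebra R K]

/-- The Rees algebra `⨁ Jⁿ Xⁿ ⊆ K[X]` of an `R`-submodule `J` of `K`. -/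
def fracRees (J : Submodule R K) : Subalgebra R (Polynomial K) where
  carrier := {p | ∀ n, p.coeff n ∈ J ^ n}
  mul_mem' {p q} hp hq n := by
    rw [Polynomial.coeff_mul]
    refine Submodule.sum_mem _ fun x hx => ?_
    rw [← Finset.HasAntidiagonal.mem_antidiagonal.mp hx, pow_add]
    exact Submodule.mul_mem_mul (hp _) (hq _)
  add_mem' {p q} hp hq n := by
    rw [Polynomial.coeff_add]
    exact Submodule.add_mem _ (hp n) (hq n)
  algebraMap_mem' a n := by
    rw [IsScalarTower.algebraMap_apply R K (Polynomial K), Polynomial.algebraMap_eq,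
      Polynomial.coeff_C]
    split_ifs with h
    · subst h
      rw [pow_zero]
      exact Submodule.algebraMap_mem a
    · exact Submodule.zero_mem _

/-- The degree `n` part `Jⁿ Xⁿ` of the Rees algebra. -/
def fracReesGrading (J : Submodule R K) (n : ℕ) : Submodule R (fracRees J) where
  carrier := {p | ∀ m, m ≠ n → p.1.coeff m = 0}
  add_mem' {p q} hp hq m hm := by simp [hp m hm, hq m hm]
  zero_mem' m _ := by simp
  smul_mem' c p hp m hm := by simp [hp m hm]

/-- `x Xⁿ` as an element of the Rees algebra, for `x ∈ Jⁿ`. -/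
def fracReesMonomial (J : Submodule R K) (n : ℕ) (x : K) (hx : x ∈ J ^ n) :
    fracReesGrading J n :=
  ⟨⟨Polynomial.monomial n x, fun m => by
      rw [Polynomial.coeff_monomial]
      split_ifs with h
      · exact h ▸ hx
      · exact Submodule.zero_mem _⟩,
    fun m hm => by
      change (Polynomial.monomial n x).coeff m = 0
      rw [Polynomial.coeff_monomial, if_neg hm.symm]⟩

lemma fracRees_coeff_coeAddMonoidHom (J : Submodule R K)
    (x : DirectSum ℕ fun n => fracReesGrading J n) (n : ℕ) :
    (DirectSum.coeAddMonoidHom (fracReesGrading J) x).1.coeff n = (x n).1.1.coeff n := by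
  classical
  induction x using DirectSum.induction_on with
  | zero => simp
  | of i y =>
    rw [DirectSum.coeAddMonoidHom_of]
    by_cases h : i = n
    · subst h
      rw [DirectSum.of_eq_same]
    · rw [y.2 n (Ne.symm h), DirectSum.of_eq_of_ne _ _ _ (Ne.symm h)]
      simp
  | add x y hx hy => simp [hx, hy]

instance (J : Submodule R K) : GradedRing (fracReesGrading J) where
  one_mem m hm := by
    change (1 : Polynomial K).coeff m = 0
    rw [Polynomial.coeff_one, if_neg hm]
  mul_mem i j p q hp hq m hm := by
    change (p.1 * q.1).coeff m = 0
    rw [Polynomial.coeff_mul]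
    refine Finset.sum_eq_zero fun x hx => ?_
    by_cases h : x.1 = i
    · have h2 : x.2 ≠ j := by
        rintro rfl
        exact hm (by rw [← Finset.HasAntidiagonal.mem_antidiagonal.mp hx, h])
      rw [hq _ h2, mul_zero]
    · rw [hp _ h, zero_mul]
  decompose' p := ∑ i ∈ p.1.support,
    DirectSum.of (fun n => fracReesGrading J n) i (fracReesMonomial J i (p.1.coeff i) (p.2 i))
  left_inv p := by
    apply Subtype.ext
    rw [map_sum]
    simp only [DirectSum.coeAddMonoidHom_of]
    rw [AddSubmonoidClass.coe_finsetSum]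
    exact p.1.as_sum_support.symm
  right_inv x := by
    have inj : Function.Injective (DirectSum.coeAddMonoidHom (fracReesGrading J)) := by
      intro x y h
      refine DFinsupp.ext fun n => Subtype.ext (Subtype.ext (Polynomial.ext fun m => ?_))
      by_cases hm : m = n
      · subst hm
        rw [← fracRees_coeff_coeAddMonoidHom, ← fracRees_coeff_coeAddMonoidHom, h]
      · rw [(x n).2 m hm, (y n).2 m hm]
    apply inj
    apply Subtype.ext
    rw [map_sum]
    simp only [DirectSum.coeAddMonoidHom_of]
    rw [AddSubmonoidClass.coe_finsetSum]
    exact (Polynomial.as_sum_support _).symm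

/-- The blowup of `Spec R` along the submodule `J` of `K`: `Proj` of the Rees algebra. -/
abbrev fracBlowup (J : Submodule R K) : Scheme.{u} := Proj (fracReesGrading J)

/-- The structure map of the blowup. -/
def fracBlowupMap (J : Submodule R K) : fracBlowup J ⟶ Spec (CommRingCat.of R) :=
  Proj.toSpecZero (fracReesGrading J) ≫
    Spec.map (CommRingCat.ofHom (algebraMap R (fracReesGrading J 0)))

/-- The map `⨁ Jⁿ Xⁿ → K`, `X ↦ 1`. -/
def fracReesEval (J : Submodule R K) : fracRees J →+* K :=
  (Polynomial.evalRingHom (1 : K)).comp (fracRees J).val.toRingHom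

lemma fracReesEval_irrelevant (J : Submodule R K) (hJ : J ≠ ⊥) :
    (HomogeneousIdeal.irrelevant (fracReesGrading J)).toIdeal.map
      ((Scheme.ΓSpecIso (CommRingCat.of K)).inv.hom.comp (fracReesEval J)) = ⊤ := by
  obtain ⟨x, hx, hx0⟩ := Submodule.exists_mem_ne_zero_of_ne_bot hJ
  let m := fracReesMonomial J 1 x (by rwa [pow_one])
  refine Ideal.eq_top_of_isUnit_mem _ (Ideal.mem_map_of_mem _ (x := m.1) ?_) ?_
  · change (GradedRing.projZeroRingHom (fracReesGrading J)) m.1 = 0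
    rw [GradedRing.projZeroRingHom_apply]
    exact DirectSum.decompose_of_mem_ne _ m.2 one_ne_zero
  · rw [RingHom.comp_apply]
    refine IsUnit.map _ ?_
    have : fracReesEval J m.1 = x := by
      change (Polynomial.monomial 1 x).eval 1 = x
      simp
    rw [this]
    exact hx0.isUnit

/-- The generic point `Spec K → Bl_J(Spec R)`, given by `⨁ Jⁿ Xⁿ → K`, `X ↦ 1`. -/
def fracBlowupGen (J : Submodule R K) (hJ : J ≠ ⊥) : Spec (CommRingCat.of K) ⟶ fracBlowup J :=
  Proj.fromOfGlobalSections (fracReesGrading J) _ (fracReesEval_irrelevant J hJ)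

lemma fracBlowupGen_map (J : Submodule R K) (hJ : J ≠ ⊥) :
    fracBlowupGen J hJ ≫ fracBlowupMap J = Spec.map (CommRingCat.ofHom (algebraMap R K)) := by
  rw [fracBlowupGen, fracBlowupMap, Proj.fromOfGlobalSections_toSpecZero_assoc,
    ← SpecMap_ΓSpecIso_hom, ← Spec.map_comp, ← Spec.map_comp]
  congr 1
  ext a
  have : fracReesEval J (algebraMap R (fracRees J) a) = algebraMap R K a := by
    change (algebraMap R (Polynomial K) a).eval 1 = _
    rw [IsScalarTower.algebraMap_apply R K (Polynomial K), Polynomial.algebraMap_eq,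
      Polynomial.eval_C]
  change (Scheme.ΓSpecIso (CommRingCat.of K)).hom.hom
    ((Scheme.ΓSpecIso (CommRingCat.of K)).inv.hom
      (fracReesEval J (algebraMap R (fracRees J) a))) = _
  rw [this]
  exact congr($((Scheme.ΓSpecIso (CommRingCat.of K)).inv_hom_id).hom (algebraMap R K a))

end Rees

/-! ### Schemes over `V = Spec R` with function field `K` -/

/-- A scheme over `Spec R` together with a `K`-valued point lying over the generic point
`Spec K → Spec R`. For an integral scheme birational to `Spec R` this point is the generic point,
and it identifies the function field of the scheme with `K`. -/
structure GenericModel (R K : Type u) [CommRing R] [Field K] [Algebra R K] where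
  /-- The underlying scheme. -/
  X : Scheme.{u}
  /-- The structure map. -/
  str : X ⟶ Spec (CommRingCat.of R)
  /-- The generic point. -/
  gen : Spec (CommRingCat.of K) ⟶ X
  gen_str : gen ≫ str = Spec.map (CommRingCat.ofHom (algebraMap R K))

/-- The blowup `Bl_J(Spec R)`, with its structure map and its generic point. -/
def blowupModel {R K : Type u} [CommRing R] [Field K] [Algebra R K] (J : Submodule R K)
    (hJ : J ≠ ⊥) : GenericModel R K where
  X := fracBlowup J
  str := fracBlowupMap J
  gen := fracBlowupGen J hJ
  gen_str := fracBlowupGen_map J hJ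

section Models

variable {k : Type v} {R K : Type u} [Field k] [Field K] [Algebra k K] [CommRing R] [Algebra R K]

/-- The map `Γ(X, U) → K`, for an open `U` which contains the generic point. -/
def GenericModel.toK (M : GenericModel R K) (U : M.X.Opens) (h : ⊤ ≤ M.gen ⁻¹ᵁ U) :
    Γ(M.X, U) →+* K :=
  (M.gen.appLE U ⊤ h ≫ (Scheme.ΓSpecIso (CommRingCat.of K)).hom).hom

lemma GenericModel.toK_str (M : GenericModel R K) (U : M.X.Opens) (h : ⊤ ≤ M.gen ⁻¹ᵁ U) (a : R) :
    algebraMap R K a ∈ (M.toK U h).range := by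
  have hU : U ≤ M.str ⁻¹ᵁ ⊤ := fun _ _ => trivial
  refine ⟨(M.str.appLE ⊤ U hU).hom ((Scheme.ΓSpecIso (CommRingCat.of R)).inv.hom a), ?_⟩
  have key : (Scheme.ΓSpecIso (CommRingCat.of R)).inv ≫ M.str.appLE ⊤ U hU ≫
      M.gen.appLE U ⊤ h ≫ (Scheme.ΓSpecIso (CommRingCat.of K)).hom =
      CommRingCat.ofHom (algebraMap R K) := by
    rw [Scheme.Hom.appLE_comp_appLE_assoc, Iso.inv_comp_eq, ← Scheme.ΓSpecIso_naturality]
    congr 1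
    simp only [M.gen_str]
    exact Scheme.Hom.appLE_eq_app ..
  exact congr($(key).hom a)

variable [Algebra k R] [IsScalarTower k R K]

variable (k) in
/-- The ring `Γ(X, U)` as a `k`-subalgebra of `K`, for an open `U` which contains the generic
point. -/
def GenericModel.sections (M : GenericModel R K) (U : M.X.Opens) (h : ⊤ ≤ M.gen ⁻¹ᵁ U) :
    Subalgebra k K where
  __ := (M.toK U h).range
  algebraMap_mem' c := by
    rw [IsScalarTower.algebraMap_apply k R K]
    exact M.toK_str U h _

variable (k) in
/-- The map from `Γ(X, U)` onto its image in `K`. -/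
def GenericModel.toSections (M : GenericModel R K) (U : M.X.Opens) (h : ⊤ ≤ M.gen ⁻¹ᵁ U) :
    Γ(M.X, U) →+* M.sections k U h :=
  (M.toK U h).codRestrict (M.sections k U h) fun x => ⟨x, rfl⟩

/-- The foliation is nonsingular on the model: on each affine part `U` the image of `Ω_{Γ(U)/k}`
in `Hom_K(L, K)` is a projective `Γ(U)`-module. -/
def SingularFoliation.IsNonsingularOn (L : SingularFoliation k K) (M : GenericModel R K) : Prop :=
  ∀ U : M.X.Opens, IsAffineOpen U → ∀ h : ⊤ ≤ M.gen ⁻¹ᵁ U,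
    Module.Projective (M.sections k U h) (L.reducedDifferentials (M.sections k U h))

/-- The morphism `π : Y → X` over `V` exhibits `Y` as the Gauss blowup of `X` along `L`, that is, as
the blowup of `X` along the rank one sheaf `Image(⋀^r Ω_{X/k} → ⋀^r Hom_K(L, K))`: every point
of `X` has an affine open neighbourhood `U` such that `π⁻¹(U) → U` is the blowup of `U` along the
module of sections of this sheaf over `U`. -/
def SingularFoliation.IsGaussBlowup (L : SingularFoliation k K) {r : ℕ}
    (δ : Module.Basis (Fin r) K L.space) (X Y : GenericModel R K) (π : Y.X ⟶ X.X) : Prop :=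
  π ≫ X.str = Y.str ∧ Y.gen ≫ π = X.gen ∧
    ∀ x : X.X, ∃ (U : X.X.Opens) (_ : x ∈ U) (hU : IsAffineOpen U) (h : ⊤ ≤ X.gen ⁻¹ᵁ U)
      (j : fracBlowup (L.topReducedDifferentials δ (X.sections k U h)) ⟶ Y.X),
      IsPullback j
        (fracBlowupMap (L.topReducedDifferentials δ (X.sections k U h)) ≫
          Spec.map (CommRingCat.ofHom (X.toSections k U h)))
        π hU.fromSpec

end Models

end

/-!
Write `𝒥(A) ⊆ K` for the module obtained from `𝒥` by viewing a subring `A` of `K` as the unit ideal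
over itself. The proof rests on four properties of `𝒥`.

* *Homogeneity.* By the Leibniz rule, multiplying all `f_i` by `a ∈ K` multiplies the determinant
  of the rows `(f_i, δ₁ f_i, …, δ_r f_i)` by `a ^ (r + 1)` (`det_rowMatrix_mul`). In characteristic
  zero the power `I ^ (r + 1)` is generated by the `(r + 1)`-st powers of elements of `I`, whence
  `I ^ (r + 1) 𝒥(J) ⊆ 𝒥(I J)` (`pow_mul_jac_le`). For `I = 𝒥(J)` this is the first assertion, and
  for invertible `I` it is an equality.
* *Nonsingularity.* Expanding the determinant along its first column shows that `𝒥(A)` is the module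
  of top reduced differentials (`topReducedDifferentials_eq_jac`). A lattice in `Kʳ` is projective
  if and only if the module generated by its `r × r` determinants is invertible: in one direction
  Cramer's rule gives a dual basis, in the other the Cauchy–Binet formula gives an inverse. So the
  reduced differentials of `A` are projective if and only if `𝒥(A)` is invertible.
* *Charts.* If `A = R[f⁻¹ J]` is a chart of the blowup along `J`, then `𝒥(J)` generates the
  `A`-module `f ^ (r + 1) 𝒥(A)` (`IsBlowupChart.span_jac`). This uses a form of the Leibniz rule for
  triple products in which the derivatives of the coefficients do not appear (`jet_mul_mul`).
* *Localization.* `𝒥(A)` commutes with localization, so its invertibility is a local question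
  (`isUnit_jac_one_of_local`).

If `𝒥(A)` is invertible then homogeneity over `A`, applied to `f ^ (r + 2) 𝒥(A) = A J 𝒥(J)`, shows
that `𝒥(J 𝒥(J))` and `𝒥(J) ^ (r + 2)` generate the same `A`-module. Since both are finitely
generated over `R`, this gives an equality over `R` after multiplication by a power of `J`.
Conversely, on a chart `C` of the blowup along `J 𝒥(J)` the modules `J` and `𝒥(J)` are principal,
and `𝒥(J 𝒥(J))` generates a multiple of `𝒥(C)`; the equality forces `𝒥(C)` to be invertible. Over
the chart `A` the module defining the Gauss blowup is `𝒥(A)`, which is generated by a multiple of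
`𝒥(J)`; so the Gauss blowup is locally the blowup along `𝒥(J)`, and the blowup along `J 𝒥(J)` is the
blowup along `J` followed by it. This last comparison does not need the equality.

On the scheme side, a reduced scheme with a dense generic point `Spec K` is handled through the
embeddings of its rings of sections in `K`. The blowup along `J` has the charts `D₊(f X)` with
coordinate rings `R[f⁻¹ J]` (`mem_sections_reesChart`), it receives a morphism from every
model on which `J` is locally principal (`exists_hom_fracBlowup`), and the comparison of blowups
follows from this universal property and the density of the generic point
(`exists_isPullback_openBlowup`).
-/

noncomputable section

/-! ### Polarization and multilinear maps on spans -/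

section Polarization

variable {k M : Type*} [Field k] [AddCommGroup M] [Module k M]

/-- Over an infinite field the coefficients of a polynomial with values in a vector space lie in
every subspace that contains all its values. -/
lemma coeff_mem_of_forall_eval_mem [Infinite k] (N : Submodule k M) (a : ℕ → M) (n : ℕ)
    (h : ∀ c : k, ∑ i ∈ Finset.range n, c ^ i • a i ∈ N) {i : ℕ} (hi : i < n) : a i ∈ N := by
  by_contra hN
  obtain ⟨φ, hφ, hker⟩ := Submodule.exists_le_ker_of_notMem hN
  let p : Polynomial k := ∑ i ∈ Finset.range n, Polynomial.C (φ (a i)) * Polynomial.X ^ i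
  have hp : p = 0 := Polynomial.funext fun c => by
    have := hker (h c)
    rw [LinearMap.mem_ker, map_sum] at this
    rw [Polynomial.eval_zero, ← this, Polynomial.eval_finsetSum]
    exact Finset.sum_congr rfl fun i _ => by
      rw [map_smul, smul_eq_mul, mul_comm]
      simp only [Polynomial.eval_mul, Polynomial.eval_C, Polynomial.eval_pow, Polynomial.eval_X]
  apply hφ
  have : p.coeff i = 0 := by rw [hp, Polynomial.coeff_zero]
  simpa [p, Polynomial.finsetSum_coeff, Polynomial.coeff_C_mul, Polynomial.coeff_X_pow, hi]
    using this

/-- Polarization: in characteristic zero, the power `I ^ n` is spanned by the powers `x ^ n`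
with `x ∈ I`. -/
lemma Submodule.pow_le_of_forall_pow_mem {k R K : Type*} [Field k] [CharZero k] [CommRing R]
    [Algebra k R] [CommRing K] [Algebra R K] {I N : Submodule R K} {n : ℕ}
    (h : ∀ x ∈ I, x ^ n ∈ N) : I ^ n ≤ N := by
  let _ : Algebra k K := Algebra.compHom K (algebraMap k R)
  have : IsScalarTower k R K := IsScalarTower.of_algebraMap_eq fun _ => rfl
  have key : ∀ j m, m + j = n → ∀ x ∈ I, ∀ w ∈ I ^ j, x ^ m * w ∈ N := by
    intro j
    induction j with
    | zero =>
      rintro m rfl x hx w hw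
      obtain ⟨a, rfl⟩ := Submodule.mem_one.mp (pow_zero I ▸ hw)
      rw [mul_comm, ← Algebra.smul_def]
      exact N.smul_mem _ (h x hx)
    | succ j ih =>
      intro m hm x hx w hw
      rw [pow_succ'] at hw
      induction hw using Submodule.mul_induction_on' with
      | add y _ z _ hy hz => rw [mul_add]; exact N.add_mem hy hz
      | mem_mul_mem y hy w hw =>
        -- the term `(m + 1) x ^ m y w` is the linear coefficient of `(x + c y) ^ (m + 1) w` in `c`
        have := coeff_mem_of_forall_eval_mem (k := k) (N.restrictScalars k)
          (fun i => x ^ (m + 1 - i) * y ^ i * ((m + 1).choose i : K) * w) (m + 2) (fun c => by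
            have := ih (m + 1) (by omega) (c • y + x)
              (I.add_mem (by rw [← algebraMap_smul R c y]; exact I.smul_mem _ hy) hx) w hw
            rw [add_pow, Finset.sum_mul] at this
            convert! this using 1
            refine Finset.sum_congr rfl fun i _ => ?_
            rw [_root_.smul_pow, Algebra.smul_def, Algebra.smul_def]
            ring) (i := 1) (by omega)
        have h0 : ((m + 1 : ℕ) : k) ≠ 0 := by exact_mod_cast m.succ_ne_zero
        have := (N.restrictScalars k).smul_mem ((m + 1 : ℕ) : k)⁻¹ this
        convert! this using 1
        simp only [Nat.add_sub_cancel, pow_one, Nat.choose_one_right]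
        have e : ((m + 1 : ℕ) : K) = algebraMap k K ((m + 1 : ℕ) : k) := by simp
        rw [Algebra.smul_def, e, show ∀ a b c d e : K, a * (b * c * d * e) = (a * d) * (b * (c * e))
          by intros; ring, ← map_mul, inv_mul_cancel₀ h0, map_one, one_mul]
  intro w hw
  simpa using key n 0 (zero_add n) 0 I.zero_mem w hw

end Polarization

/-- A multilinear map sends tuples of elements of a span into a submodule if it does so for tuples
of generators. -/
lemma MultilinearMap.map_mem_of_mem_span {A M N ι : Type*} [CommRing A] [AddCommGroup M]
    [Module A M] [AddCommGroup N] [Module A N] [Finite ι]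
    (f : MultilinearMap A (fun _ : ι => M) N) {S : Set M} {P : Submodule A N}
    (h : ∀ v : ι → M, (∀ i, v i ∈ S) → f v ∈ P) (v : ι → M)
    (hv : ∀ i, v i ∈ Submodule.span A S) : f v ∈ P := by
  classical
  have := Fintype.ofFinite ι
  suffices H : ∀ (s : Finset ι) (v : ι → M), (∀ i ∈ s, v i ∈ Submodule.span A S) →
      (∀ i ∉ s, v i ∈ S) → f v ∈ P from
    H Finset.univ v (fun i _ => hv i) fun i hi => (hi (Finset.mem_univ i)).elim
  intro s
  induction s using Finset.induction_on with
  | empty => exact fun v _ hv => h v fun i => hv i (Finset.notMem_empty i)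
  | insert a s ha ih =>
    intro v hv hv'
    suffices H : ∀ x ∈ Submodule.span A S, f (Function.update v a x) ∈ P by
      simpa using H (v a) (hv a (Finset.mem_insert_self a s))
    intro x hx
    induction hx using Submodule.span_induction with
    | mem x hx =>
      refine ih _ (fun i hi => ?_) (fun i hi => ?_)
      · rw [Function.update_of_ne (ne_of_mem_of_not_mem hi ha)]
        exact hv i (Finset.mem_insert_of_mem hi)
      · by_cases hia : i = a
        · subst hia; simpa using hx
        · rw [Function.update_of_ne hia]
          exact hv' i (by simp [hia, hi])
    | zero => rw [f.map_update_zero]; exact P.zero_mem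
    | add x y _ _ hx hy => rw [f.map_update_add]; exact P.add_mem hx hy
    | smul c x _ hx => rw [f.map_update_smul]; exact P.smul_mem c hx

/-- The restriction to `A` of the determinant of a square matrix over `K`, as a multilinear map of
its rows. -/
def detRows (A : Type*) {K : Type*} [CommRing A] [Field K] [Algebra A K] (n : ℕ) :
    MultilinearMap A (fun _ : Fin n => Fin n → K) K :=
  (Matrix.detRowAlternating (R := K) (n := Fin n)).toMultilinearMap.restrictScalars A

lemma detRows_apply (A : Type*) {K : Type*} [CommRing A] [Field K] [Algebra A K] (n : ℕ)
    (v : Fin n → Fin n → K) : detRows A n v = (Matrix.of v).det := rfl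

/-! ### First order rows -/

namespace SingularFoliation

section Jac

variable {k : Type v} {K : Type u} [Field k] [Field K] [Algebra k K] (L : SingularFoliation k K)
  {r : ℕ} (δ : Module.Basis (Fin r) K L.space)

/-- The first order jet `(x, δ₁ x, …, δ_r x)` of `x ∈ K` along the foliation. -/
def jet : K →ₗ[k] (Fin (r + 1) → K) where
  toFun x := Fin.cons x fun j => (δ j).1 x
  map_add' x y := by
    ext i
    refine Fin.cases ?_ (fun j => ?_) i <;> simp
  map_smul' c x := by
    ext i
    refine Fin.cases ?_ (fun j => ?_) i <;> simp

@[simp] lemma jet_zero_apply (x : K) : L.jet δ x 0 = x := rfl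

@[simp] lemma jet_succ_apply (x : K) (j : Fin r) : L.jet δ x j.succ = (δ j).1 x := rfl

/-- The Leibniz rule for jets of triple products, in a form free of second order terms. -/
lemma jet_mul_mul (x y z : K) :
    L.jet δ (x * y * z) =
      x • L.jet δ (y * z) + y • L.jet δ (x * z) - (x * y) • L.jet δ z := by
  ext i
  refine Fin.cases ?_ (fun j => ?_) i
  · simp; ring
  · simp; ring

lemma rowMatrix_eq (f : Fin (r + 1) → K) :
    L.rowMatrix δ f = Matrix.of fun i => L.jet δ (f i) := rfl

/-- The determinant of the rows `(f_i, δ₁ f_i, …, δ_r f_i)` is homogeneous in `f`, even for factors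
which are not constant along the foliation. -/
lemma det_rowMatrix_mul (a : K) (f : Fin (r + 1) → K) :
    (L.rowMatrix δ fun i => a * f i).det = a ^ (r + 1) * (L.rowMatrix δ f).det := by
  let N : Matrix (Fin (r + 1)) (Fin (r + 1)) K := Matrix.of fun i j =>
    if i = j then a else if i = 0 then L.jet δ a j else 0
  have hN : N.det = a ^ (r + 1) := by
    rw [Matrix.det_of_isUpperTriangular]
    · simp [N]
    · intro i j hij
      have h1 : i ≠ j := hij.ne'
      have h2 : i ≠ 0 := fun h => by subst h; exact absurd hij (by simp)
      simp [N, h1, h2]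
  have : (L.rowMatrix δ fun i => a * f i) = L.rowMatrix δ f * N := by
    ext i j
    rw [Matrix.mul_apply, Fin.sum_univ_succ]
    refine Fin.cases ?_ (fun j => ?_) j
    · simp [N, rowMatrix_eq, mul_comm]
    · rw [Finset.sum_eq_single j]
      · simp [N, rowMatrix_eq, (Fin.succ_ne_zero j).symm]
        ring
      · intro b _ hb
        simp [N, hb]
      · simp
  rw [this, Matrix.det_mul, hN, mul_comm]

section

variable {R : Type u} [CommRing R] [Algebra R K]

lemma det_mem_jac {J : Submodule R K} {f : Fin (r + 1) → K} (hf : ∀ i, f i ∈ J) :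
    (L.rowMatrix δ f).det ∈ L.jac δ J :=
  Submodule.subset_span ⟨fun i => ⟨f i, hf i⟩, rfl⟩

lemma jac_le {J N : Submodule R K}
    (h : ∀ f : Fin (r + 1) → K, (∀ i, f i ∈ J) → (L.rowMatrix δ f).det ∈ N) : L.jac δ J ≤ N :=
  Submodule.span_le.mpr <| by
    rintro _ ⟨f, rfl⟩
    exact h _ fun i => (f i).2

/-- If the jets of the elements of `J` lie in the span of the jets of the elements of `S`, then
`𝒥(J)` is generated by the determinants with entries in `S`. -/
lemma jac_le_of_jet_mem_span {J N : Submodule R K} {S : Set K}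
    (hS : ∀ x ∈ J, L.jet δ x ∈ Submodule.span R (L.jet δ '' S))
    (h : ∀ f : Fin (r + 1) → K, (∀ i, f i ∈ S) → (L.rowMatrix δ f).det ∈ N) : L.jac δ J ≤ N := by
  refine L.jac_le δ fun f hf => ?_
  refine (detRows R (r + 1)).map_mem_of_mem_span (S := L.jet δ '' S) (fun v hv => ?_)
    (fun i => L.jet δ (f i)) fun i => hS _ (hf i)
  choose g hg hgv using hv
  obtain rfl : (fun i => L.jet δ (g i)) = v := funext hgv
  exact h g hg

variable [Algebra k R] [CharZero k]

/-- The basic inclusion: the case of principal `I` is the homogeneity of the determinant, and the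
general case follows by polarization. -/
lemma pow_mul_jac_le (I J : Submodule R K) :
    I ^ (r + 1) * L.jac δ J ≤ L.jac δ (I * J) := by
  refine Submodule.mul_le.mpr fun x hx y hy => ?_
  suffices h : I ^ (r + 1) ≤
      (L.jac δ (I * J)).comap (LinearMap.mulRight R y) from h hx
  refine Submodule.pow_le_of_forall_pow_mem (k := k) fun (a : K) (ha : a ∈ I) => ?_
  suffices h : L.jac δ J ≤ (L.jac δ (I * J)).comap (LinearMap.mulLeft R (a ^ (r + 1))) from h hy
  refine L.jac_le δ fun f hf => ?_
  change a ^ (r + 1) * (L.rowMatrix δ f).det ∈ L.jac δ (I * J)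
  rw [← det_rowMatrix_mul]
  exact L.det_mem_jac δ fun i => Submodule.mul_mem_mul ha (hf i)

lemma jac_mul_of_isUnit {I : Submodule R K} (hI : IsUnit I) (J : Submodule R K) :
    L.jac δ (I * J) = I ^ (r + 1) * L.jac δ J := by
  refine le_antisymm ?_ (L.pow_mul_jac_le δ I J)
  obtain ⟨I', h⟩ := hI.exists_right_inv
  calc L.jac δ (I * J) = I ^ (r + 1) * (I' ^ (r + 1) * L.jac δ (I * J)) := by
        rw [← mul_assoc, ← mul_pow, h, one_pow, one_mul]
    _ ≤ I ^ (r + 1) * L.jac δ (I' * (I * J)) :=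
        mul_le_mul' le_rfl (L.pow_mul_jac_le δ _ _)
    _ = I ^ (r + 1) * L.jac δ J := by rw [← mul_assoc, mul_comm I', h, one_mul]

lemma jac_eq_of_isUnit {I : Submodule R K} (hI : IsUnit I) :
    L.jac δ I = I ^ (r + 1) * L.jac δ 1 := by
  rw [← L.jac_mul_of_isUnit δ hI, mul_one]

end

end Jac

end SingularFoliation

/-! ### Lattices and their determinant modules -/

/-- The Cauchy–Binet formula, as a sum over all tuples of indices. -/
lemma Matrix.factorial_mul_det_mul {R ι : Type*} [CommRing R] [Fintype ι] {n : ℕ}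
    (Φ : Matrix (Fin n) ι R) (Q : Matrix ι (Fin n) R) :
    (n.factorial : R) * (Φ * Q).det =
      ∑ s : Fin n → ι, (Φ.submatrix id s).det * (Q.submatrix s id).det := by
  classical
  have h1 : (Φ * Q).det = ∑ s : Fin n → ι, (∏ j, Φ j (s j)) * (Q.submatrix s id).det := by
    have e : Φ * Q = Matrix.of fun j => ∑ p, Φ j p • Q p := by
      ext j l
      simp [Matrix.mul_apply]
    rw [e]
    change Matrix.detRowAlternating.toMultilinearMap (fun j => ∑ p, Φ j p • Q p) = _
    rw [MultilinearMap.map_sum]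
    refine Finset.sum_congr rfl fun s _ => ?_
    rw [MultilinearMap.map_smul_univ]
    rfl
  have h2 : ∀ σ : Equiv.Perm (Fin n), (Φ * Q).det =
      ∑ s : Fin n → ι, (Equiv.Perm.sign σ : R) * (∏ j, Φ (σ j) (s j)) *
        (Q.submatrix s id).det := by
    intro σ
    rw [h1, ← (Equiv.arrowCongr σ (Equiv.refl ι)).sum_comp]
    refine Finset.sum_congr rfl fun s _ => ?_
    have e1 : ∏ j, Φ j ((Equiv.arrowCongr σ (Equiv.refl ι)) s j) = ∏ j, Φ (σ j) (s j) := by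
      rw [← Equiv.prod_comp σ]
      simp [Equiv.arrowCongr_apply]
    have e2 : (Q.submatrix ((Equiv.arrowCongr σ (Equiv.refl ι)) s) id).det =
        (Equiv.Perm.sign σ : R) * (Q.submatrix s id).det := by
      rw [← Equiv.Perm.sign_symm σ, ← Matrix.det_permute]
      rfl
    rw [e1, e2]
    ring
  have h3 : (n.factorial : R) * (Φ * Q).det = ∑ _σ : Equiv.Perm (Fin n), (Φ * Q).det := by
    rw [Finset.sum_const, Finset.card_univ, Fintype.card_perm, Fintype.card_fin, nsmul_eq_mul]
  rw [h3, Finset.sum_congr rfl fun σ _ => h2 σ, Finset.sum_comm]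
  refine Finset.sum_congr rfl fun s _ => ?_
  rw [← Finset.sum_mul, Matrix.det_apply' (Φ.submatrix id s)]
  rfl

section Lattice

variable {A K : Type*} [CommRing A] [Field K] [Algebra A K] {n : ℕ}

/-- The `A`-submodule of `K` generated by the determinants of tuples of vectors of `M ⊆ Kⁿ`: the
image of `⋀ⁿ M` in `⋀ⁿ Kⁿ = K`. -/
def detModule (M : Submodule A (Fin n → K)) : Submodule A K :=
  Submodule.span A (Set.range fun v : Fin n → M => (Matrix.of fun i => (v i : Fin n → K)).det)

lemma det_mem_detModule {M : Submodule A (Fin n → K)} {v : Fin n → Fin n → K}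
    (hv : ∀ i, v i ∈ M) : (Matrix.of v).det ∈ detModule M :=
  Submodule.subset_span ⟨fun i => ⟨v i, hv i⟩, rfl⟩

/-- If the determinant module of `M` is invertible then Cramer's rule provides a dual basis
of `M`. -/
lemma projective_of_isUnit_detModule [FaithfulSMul A K] {M : Submodule A (Fin n → K)}
    (h : IsUnit (detModule M)) : Module.Projective A M := by
  classical
  obtain ⟨T', hT'⟩ := h.exists_right_inv
  -- the scalars `c` for which multiplication by `c` on `M` factors through a free module
  let E : Submodule A K :=
    { carrier := {c | ∃ s : M →ₗ[A] (M →₀ A), ∀ m : M,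
        ((Finsupp.linearCombination A id (s m) : M) : Fin n → K) = c • (m : Fin n → K)}
      add_mem' := by
        rintro a b ⟨s, hs⟩ ⟨s', hs'⟩
        exact ⟨s + s', fun m => by simp [hs, hs', add_smul]⟩
      zero_mem' := ⟨0, fun m => by simp⟩
      smul_mem' := by
        rintro a c ⟨s, hs⟩
        exact ⟨a • s, fun m => by simp [hs]⟩ }
  have key : detModule M * T' ≤ E := by
    refine Submodule.mul_le.mpr fun x hx t ht => ?_
    have hle : detModule M ≤ E.comap (LinearMap.mulRight A t) := by
      refine Submodule.span_le.mpr ?_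
      rintro _ ⟨p, rfl⟩
      let P : Fin n → Fin n → K := fun i => p i
      let e := LinearEquiv.ofInjective (Algebra.linearMap A K)
        (FaithfulSMul.algebraMap_injective A K)
      let φ : Fin n → M →ₗ[A] A := fun i =>
        e.symm.toLinearMap ∘ₗ LinearMap.codRestrict (LinearMap.range (Algebra.linearMap A K))
          (LinearMap.mulRight A t ∘ₗ (detRows A n).toLinearMap P i ∘ₗ M.subtype) (fun m => by
            rw [← Submodule.one_eq_range, ← hT']
            refine Submodule.mul_mem_mul (det_mem_detModule fun j => ?_) ht
            change Function.update P i (m : Fin n → K) j ∈ M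
            rcases eq_or_ne j i with rfl | hj
            · rw [Function.update_self]; exact m.2
            · rw [Function.update_of_ne hj]; exact (p j).2)
      have hφ : ∀ i (m : M), algebraMap A K (φ i m) =
          (Matrix.of (Function.update P i (m : Fin n → K))).det * t := fun i m =>
        congrArg Subtype.val (e.apply_symm_apply _)
      refine ⟨∑ i, Finsupp.lsingle (p i) ∘ₗ φ i, fun m => ?_⟩
      have hc := (Matrix.of P).transpose.mulVec_cramer m
      rw [Matrix.det_transpose] at hc
      simp only [LinearMap.sum_apply, map_sum, LinearMap.comp_apply, Finsupp.lsingle_apply,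
        Finsupp.linearCombination_single, id, AddSubmonoidClass.coe_finsetSum, Submodule.coe_smul,
        LinearMap.mulRight_apply]
      rw [mul_comm, mul_smul]
      erw [← hc]
      ext j
      rw [Pi.smul_apply, Matrix.mulVec_eq_sum, Finset.sum_apply, Finset.sum_apply, Finset.smul_sum]
      refine Finset.sum_congr rfl fun i _ => ?_
      rw [Pi.smul_apply, ← algebraMap_smul K, hφ, Matrix.cramer_transpose_apply]
      simp only [op_smul_eq_smul, Pi.smul_apply, smul_eq_mul, Matrix.transpose_transpose,
        Matrix.of_apply]
      rw [mul_comm _ t, mul_assoc]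
      rfl
    exact hle hx
  obtain ⟨s, hs⟩ := key (hT'.ge (Submodule.one_le.mp le_rfl))
  exact Module.projective_def.mpr ⟨s, fun m => Subtype.ext (by rw [hs, one_smul])⟩

/-- A finite rank projective lattice has an invertible determinant module: the Cauchy–Binet
formula, applied to a dual basis, gives the inverse. -/
lemma isUnit_detModule_of_projective [IsDomain A] [IsFractionRing A K]
    (hn : IsUnit (n.factorial : A)) {M : Submodule A (Fin n → K)} (hM : detModule M ≠ ⊥)
    [Module.Projective A M] : IsUnit (detModule M) := by
  classical
  obtain ⟨e, he⟩ : ∃ e : Fin n → M, (Matrix.of fun i => (e i : Fin n → K)).det ≠ 0 := by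
    by_contra! h
    refine hM (Submodule.span_eq_bot.mpr ?_)
    rintro _ ⟨v, rfl⟩
    exact h v
  set P : Matrix (Fin n) (Fin n) K := Matrix.of fun i => (e i : Fin n → K) with hP
  have hPu : IsUnit P.det := he.isUnit
  obtain ⟨s, hs⟩ := Module.projective_def.mp ‹Module.Projective A M›
  let I : Finset M := Finset.univ.biUnion fun j => (s (e j)).support
  let Φ : Matrix (Fin n) I K := Matrix.of fun j p => algebraMap A K (s (e j) p)
  let Q : Matrix I (Fin n) K := Matrix.of fun p => (p : Fin n → K)
  have hPQ : P = Φ * Q := by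
    ext j l
    have h1 : e j = ∑ p ∈ I, s (e j) p • p := by
      conv_lhs => rw [← hs (e j), Finsupp.linearCombination_apply]
      refine Finsupp.sum_of_support_subset _ (fun p hp => ?_) _ (by simp)
      exact Finset.mem_biUnion.mpr ⟨j, Finset.mem_univ _, hp⟩
    have h2 := congrArg (fun m : M => (m : Fin n → K) l) h1
    rw [Matrix.mul_apply]
    change (e j : Fin n → K) l = _
    rw [h2, ← Finset.sum_coe_sort]
    simp [Φ, Q, Algebra.smul_def]
  -- the coordinate functions of `s` extend linearly over `K`
  have hcoord : ∀ (m : M) (p : M), algebraMap A K (s m p) =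
      ∑ j, Matrix.vecMul (m : Fin n → K) P⁻¹ j * algebraMap A K (s (e j) p) := by
    intro m p
    obtain ⟨b, hb⟩ := IsLocalization.exist_integer_multiples_of_finite (nonZeroDivisors A)
      (fun j => Matrix.vecMul (m : Fin n → K) P⁻¹ j)
    choose a ha using hb
    have hb0 : algebraMap A K b ≠ 0 := IsFractionRing.to_map_ne_zero_of_mem_nonZeroDivisors b.2
    have h1 : (b : A) • m = ∑ j, a j • e j := by
      apply Subtype.ext
      have : (m : Fin n → K) = Matrix.vecMul (Matrix.vecMul (m : Fin n → K) P⁻¹) P := by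
        rw [Matrix.vecMul_vecMul, Matrix.nonsing_inv_mul _ hPu, Matrix.vecMul_one]
      rw [Submodule.coe_smul]
      conv_lhs => rw [this]
      ext l
      rw [AddSubmonoidClass.coe_finsetSum, Finset.sum_apply, Pi.smul_apply, Matrix.vecMul,
        dotProduct, Finset.smul_sum]
      refine Finset.sum_congr rfl fun j _ => ?_
      rw [Submodule.coe_smul, Pi.smul_apply, ← algebraMap_smul K (a j), ha j, ← smul_mul_assoc]
      rfl
    have h2 := congrArg (fun m => algebraMap A K (s m p)) h1
    simp only [map_smul, map_sum, Finsupp.coe_smul, Finsupp.coe_finsetSum, Finset.sum_apply,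
      Pi.smul_apply, smul_eq_mul, map_mul] at h2
    refine mul_left_cancel₀ hb0 (h2.trans ?_)
    rw [Finset.mul_sum]
    refine Finset.sum_congr rfl fun j _ => ?_
    rw [ha j, Algebra.smul_def, mul_assoc]
  obtain ⟨u, hu⟩ := hn
  let τ : (Fin n → I) → K := fun q => algebraMap A K ↑u⁻¹ * ((Φ.submatrix id q).det / P.det)
  let T' : Submodule A K := Submodule.span A (Set.range τ)
  refine IsUnit.of_mul_eq_one T' (le_antisymm ?_ ?_)
  · rw [detModule, Submodule.span_mul_span, Submodule.span_le]
    rintro _ ⟨_, ⟨v, rfl⟩, _, ⟨q, rfl⟩, rfl⟩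
    let C : Matrix (Fin n) (Fin n) K := Matrix.of fun i => Matrix.vecMul (v i : Fin n → K) P⁻¹
    have hC : (Matrix.of fun i => (v i : Fin n → K)) = C * P := by
      ext i l
      change _ = Matrix.vecMul (C i) P l
      change _ = Matrix.vecMul (Matrix.vecMul (v i : Fin n → K) P⁻¹) P l
      rw [Matrix.vecMul_vecMul, Matrix.nonsing_inv_mul _ hPu, Matrix.vecMul_one]
      rfl
    have hCΦ : C * Φ.submatrix id q =
        (Matrix.of fun i l => s (v i) (q l)).map (algebraMap A K) := by
      ext i l
      rw [Matrix.mul_apply, Matrix.map_apply, Matrix.of_apply, hcoord]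
      rfl
    refine Submodule.mem_one.mpr ⟨↑u⁻¹ * (Matrix.of fun i l => s (v i) (q l)).det, ?_⟩
    rw [map_mul, RingHom.map_det, RingHom.mapMatrix_apply, ← hCΦ, Matrix.det_mul]
    simp only [τ]
    rw [hC, Matrix.det_mul]
    field_simp
  · rw [Submodule.one_le]
    have h1 := Matrix.factorial_mul_det_mul Φ Q
    rw [← hPQ] at h1
    have h2 : (1 : K) = ∑ q : Fin n → I, (Q.submatrix q id).det * τ q := by
      have hu' : algebraMap A K ↑u⁻¹ * (n.factorial : K) = 1 := by
        rw [← map_natCast (algebraMap A K), ← hu, ← map_mul, Units.inv_mul, map_one]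
      calc (1 : K) = algebraMap A K ↑u⁻¹ * ((n.factorial : K) * P.det) / P.det := by
            rw [← mul_assoc, hu', one_mul, div_self he]
        _ = _ := by
            rw [h1, mul_div_assoc, Finset.sum_div, Finset.mul_sum]
            refine Finset.sum_congr rfl fun q _ => ?_
            simp only [τ]
            ring
    rw [h2]
    refine Submodule.sum_mem _ fun q _ => Submodule.mul_mem_mul ?_ (Submodule.subset_span ⟨q, rfl⟩)
    exact det_mem_detModule fun i => (q i).1.2

end Lattice

/-! ### Reduced differentials and jets -/

namespace SingularFoliation

section Reduced

variable {k : Type v} {K : Type u} [Field k] [Field K] [Algebra k K] (L : SingularFoliation k K)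
  {r : ℕ} (δ : Module.Basis (Fin r) K L.space) (A : Subalgebra k K)

/-- The coordinates `Hom_K(L, K) → K^r` given by the basis of `L`. -/
def dualCoord : Module.Dual K L.space →ₗ[K] (Fin r → K) where
  toFun ω j := ω (δ j)
  map_add' _ _ := rfl
  map_smul' _ _ := rfl

lemma dualCoord_injective : Function.Injective (L.dualCoord δ) := fun _ _ h =>
  δ.ext fun j => congrFun h j

/-- The reduced differentials, in coordinates. -/
def reducedLattice : Submodule A (Fin r → K) :=
  (L.reducedDifferentials A).map ((L.dualCoord δ).restrictScalars A)

lemma reducedDifferentials_eq_span :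
    L.reducedDifferentials A = Submodule.span A (Set.range (L.dbar A)) := by
  rw [reducedDifferentials, LinearMap.range_eq_map, ← KaehlerDifferential.span_range_derivation,
    Submodule.map_span, ← Set.range_comp]
  congr 2
  ext1 x
  exact Derivation.liftKaehlerDifferential_comp_D _ x

lemma reducedLattice_eq_span :
    L.reducedLattice δ A =
      Submodule.span A (Set.range fun (a : A) (j : Fin r) => (δ j).1 (a : K)) := by
  rw [reducedLattice, reducedDifferentials_eq_span, Submodule.map_span, ← Set.range_comp]
  rfl

lemma topReducedDifferentials_eq_detModule :
    L.topReducedDifferentials δ A = detModule (L.reducedLattice δ A) := by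
  refine le_antisymm (Submodule.span_le.mpr ?_) (Submodule.span_le.mpr ?_)
  · rintro _ ⟨ω, rfl⟩
    exact det_mem_detModule fun i => ⟨_, (ω i).2, rfl⟩
  · rintro _ ⟨v, rfl⟩
    choose ω hω hv using fun i => (v i).2
    refine Submodule.subset_span ⟨fun i => ⟨ω i, hω i⟩, ?_⟩
    exact congrArg (fun w => (Matrix.of w).det) (funext hv)

/-- The top reduced differentials form the module `𝒥(A)` of the unit ideal. -/
lemma topReducedDifferentials_eq_jac :
    L.topReducedDifferentials δ A = L.jac δ (1 : Submodule A K) := by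
  rw [topReducedDifferentials_eq_detModule]
  refine le_antisymm (Submodule.span_le.mpr ?_) (L.jac_le δ fun f hf => ?_)
  · rintro _ ⟨v, rfl⟩
    refine (detRows A r).map_mem_of_mem_span
      (S := Set.range fun (a : A) (j : Fin r) => (δ j).1 (a : K)) (fun w hw => ?_) _
      fun i => by rw [← reducedLattice_eq_span]; exact (v i).2
    choose a ha using hw
    have : detRows A r w = (L.rowMatrix δ (Fin.cons 1 fun i => (a i : K))).det := by
      rw [Matrix.det_succ_row_zero, Fin.sum_univ_succ, Finset.sum_eq_zero]
      · simp only [detRows_apply, rowMatrix, Fin.val_zero, pow_zero, one_mul, Matrix.of_apply,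
          Fin.cons_zero, add_zero]
        congr 1
        ext i j
        simp [← ha]
      · intro j _
        simp [rowMatrix]
    rw [this]
    refine L.det_mem_jac δ fun i => ?_
    refine Fin.cases (Submodule.one_le.mp le_rfl) (fun i => ?_) i
    exact Submodule.mem_one.mpr ⟨a i, rfl⟩
  · rw [Matrix.det_succ_column_zero]
    refine Submodule.sum_mem _ fun i _ => ?_
    choose a ha using fun i => Submodule.mem_one.mp (hf i)
    have : L.rowMatrix δ f i 0 = algebraMap A K (a i) := by rw [ha]; rfl
    rw [this, mul_assoc, mul_left_comm, ← Algebra.smul_def]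
    refine Submodule.smul_mem _ _ ?_
    have h : ((L.rowMatrix δ f).submatrix i.succAbove Fin.succ).det ∈
        detModule (L.reducedLattice δ A) := by
      refine det_mem_detModule (v := fun l j => (δ j).1 (f (i.succAbove l))) fun l => ?_
      rw [reducedLattice_eq_span]
      refine Submodule.subset_span ⟨a (i.succAbove l), ?_⟩
      dsimp only
      rw [← ha]
      rfl
    rcases neg_one_pow_eq_or K (i : ℕ) with e | e <;> rw [e]
    · rwa [one_mul]
    · rw [neg_one_mul]; exact Submodule.neg_mem _ h

variable {A}

lemma projective_reducedDifferentials (h : IsUnit (L.jac δ (1 : Submodule A K))) :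
    Module.Projective A (L.reducedDifferentials A) := by
  rw [← topReducedDifferentials_eq_jac, topReducedDifferentials_eq_detModule] at h
  have : Module.Projective A ((L.reducedDifferentials A).map
      ((L.dualCoord δ).restrictScalars A)) := projective_of_isUnit_detModule h
  exact Module.Projective.of_equiv (Submodule.equivMapOfInjective
    ((L.dualCoord δ).restrictScalars A) (L.dualCoord_injective δ) (L.reducedDifferentials A)).symm

lemma isUnit_jac_of_projective [CharZero k] [IsFractionRing A K]
    [Module.Projective A (L.reducedDifferentials A)] : IsUnit (L.jac δ (1 : Submodule A K)) := by
  have hbot : L.jac δ (1 : Submodule A K) ≠ ⊥ := L.jac_ne_bot δ one_ne_zero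
  rw [← topReducedDifferentials_eq_jac, topReducedDifferentials_eq_detModule] at hbot ⊢
  have : Module.Projective A (L.reducedLattice δ A) :=
    Module.Projective.of_equiv (Submodule.equivMapOfInjective
      ((L.dualCoord δ).restrictScalars A) (L.dualCoord_injective δ) (L.reducedDifferentials A))
  refine isUnit_detModule_of_projective ?_ hbot
  rw [← map_natCast (algebraMap k A)]
  exact (Nat.cast_ne_zero.mpr r.factorial_ne_zero).isUnit.map _

end Reduced

end SingularFoliation

/-! ### Extension of scalars inside `K` -/

section Extension

variable {R A K : Type*} [CommRing R] [CommRing A] [Field K] [Algebra R K] [Algebra A K]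

lemma Submodule.span_coe_mul (I J : Submodule R K) :
    span A ((I * J : Submodule R K) : Set K) = span A (I : Set K) * span A (J : Set K) := by
  refine le_antisymm (span_le.mpr fun x hx => ?_) ?_
  · rw [SetLike.mem_coe] at hx
    induction hx using Submodule.mul_induction_on' with
    | mem_mul_mem a ha b hb => exact mul_mem_mul (subset_span ha) (subset_span hb)
    | add x _ y _ hx hy => exact add_mem hx hy
  · rw [span_mul_span]
    refine span_mono ?_
    rintro _ ⟨a, ha, b, hb, rfl⟩
    exact mul_mem_mul ha hb

lemma Submodule.span_coe_pow_succ (J : Submodule R K) (n : ℕ) :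
    span A ((J ^ (n + 1) : Submodule R K) : Set K) = span A (J : Set K) ^ (n + 1) := by
  induction n with
  | zero => simp
  | succ n ih => rw [pow_succ, span_coe_mul, ih, pow_succ _ (n + 1)]

lemma Submodule.isUnit_span_singleton {a : K} (ha : a ≠ 0) :
    IsUnit (Submodule.span A ({a} : Set K)) :=
  IsUnit.of_mul_eq_one (Submodule.span A {a⁻¹}) (by
    rw [Submodule.span_mul_span, Set.singleton_mul_singleton, mul_inv_cancel₀ ha,
      Submodule.one_eq_span])

end Extension

/-! ### Saturation and local invertibility -/

section Saturation

variable {B K : Type*} [CommRing B] [Field K] [Algebra B K]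

/-- The saturation `{x | sⁿ x ∈ N for some n}` of a submodule. -/
def Submodule.saturation (s : B) (N : Submodule B K) : Submodule B K where
  carrier := {x | ∃ n : ℕ, s ^ n • x ∈ N}
  add_mem' := by
    rintro x y ⟨n, hx⟩ ⟨m, hy⟩
    refine ⟨n + m, ?_⟩
    rw [smul_add, pow_add, mul_smul, mul_smul, smul_comm (s ^ n) (s ^ m) x]
    exact N.add_mem (N.smul_mem _ hx) (N.smul_mem _ hy)
  zero_mem' := ⟨0, by simp⟩
  smul_mem' := by
    rintro b x ⟨n, hx⟩
    exact ⟨n, by rw [smul_comm]; exact N.smul_mem _ hx⟩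

lemma Submodule.mul_saturation_le (s : B) (P N : Submodule B K) :
    P * N.saturation s ≤ (P * N).saturation s := by
  refine Submodule.mul_le.mpr ?_
  rintro p hp x ⟨n, hx⟩
  refine ⟨n, ?_⟩
  rw [← mul_smul_comm]
  exact Submodule.mul_mem_mul hp hx

/-- Membership in a submodule is local. -/
lemma Submodule.mem_of_forall_mem_saturation {S : Set B} (hS : Ideal.span S = ⊤)
    {N : Submodule B K} {x : K} (h : ∀ s ∈ S, x ∈ N.saturation s) : x ∈ N := by
  choose n hn using fun s : S => h s s.2
  have h1 : (Ideal.span (Set.range fun s : S => (s : B) ^ n s)) ≤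
      N.comap (LinearMap.toSpanSingleton B K x) := by
    refine Ideal.span_le.mpr ?_
    rintro _ ⟨s, rfl⟩
    exact hn s
  rw [Ideal.span_range_pow_eq_top S hS n] at h1
  simpa using h1 (Submodule.mem_top (x := (1 : B)))

/-- Invertibility of a submodule is local. -/
lemma Submodule.isUnit_of_local {T : Submodule B K} {S : Set B} (hS : Ideal.span S = ⊤)
    (h : ∀ s ∈ S, ∃ T' : Submodule B K, 1 ∈ T * T' ∧
      T * T' ≤ (1 : Submodule B K).saturation s) : IsUnit T := by
  classical
  obtain ⟨S', hS'S, hS'⟩ := (Submodule.mem_span_finite_of_mem_span (show (1 : B) ∈ Ideal.span S by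
    rw [hS]; trivial))
  replace hS' : Ideal.span (S' : Set B) = ⊤ := (Ideal.eq_top_iff_one _).mpr hS'
  choose T' h1 hT' using fun s : S' => h s (hS'S s.2)
  choose F F' hF hF' h1 using fun s : S' => Submodule.mem_span_mul_finite_of_mem_mul (h1 s)
  let G : Finset K := Finset.univ.biUnion F
  have hGT : T = Submodule.span B (G : Set K) := by
    refine le_antisymm (fun t ht => ?_) (Submodule.span_le.mpr fun x hx => ?_)
    · refine Submodule.mem_of_forall_mem_saturation hS' fun s hs => ?_
      have e := h1 ⟨s, hs⟩
      rw [← Submodule.span_mul_span] at e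
      have : t * 1 ∈ Submodule.span B {t} *
          (Submodule.span B (F ⟨s, hs⟩ : Set K) * Submodule.span B (F' ⟨s, hs⟩ : Set K)) :=
        Submodule.mul_mem_mul (Submodule.mem_span_singleton_self t) e
      rw [mul_one, mul_left_comm] at this
      have hle : Submodule.span B {t} * Submodule.span B (F' ⟨s, hs⟩ : Set K) ≤
          (1 : Submodule B K).saturation s :=
        (mul_le_mul' ((Submodule.span_singleton_le_iff_mem _ _).mpr ht)
          (Submodule.span_le.mpr (hF' _))).trans (hT' ⟨s, hs⟩)
      have h2 := Submodule.mul_saturation_le s _ 1 (mul_le_mul' le_rfl hle this)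
      rw [mul_one] at h2
      obtain ⟨n, hn⟩ := h2
      refine ⟨n, Submodule.span_mono ?_ hn⟩
      exact_mod_cast Finset.subset_biUnion_of_mem F (Finset.mem_univ _)
    · obtain ⟨s, -, hx⟩ := Finset.mem_biUnion.mp hx
      exact hF s hx
  refine IsUnit.of_mul_eq_one (1 / T) (le_antisymm Submodule.mul_one_div_le_one ?_)
  rw [Submodule.one_le]
  refine Submodule.mem_of_forall_mem_saturation hS' fun s hs => ?_
  have hle : Submodule.span B (F' ⟨s, hs⟩ : Set K) ≤ (1 / T).saturation s := by
    refine Submodule.span_le.mpr fun y hy => ?_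
    have hyT : ∀ g : G, ∃ n : ℕ, s ^ n • (y * g) ∈ (1 : Submodule B K) := fun g =>
      hT' ⟨s, hs⟩ (by
        rw [mul_comm y]
        exact Submodule.mul_mem_mul (by rw [hGT]; exact Submodule.subset_span g.2) (hF' _ hy))
    choose n hn using hyT
    refine ⟨∑ g, n g, ?_⟩
    rw [Submodule.mem_div_iff_forall_mul_mem]
    suffices H : T ≤ (1 : Submodule B K).comap (LinearMap.mulLeft B (s ^ (∑ g, n g) • y)) from
      fun t ht => H ht
    rw [hGT]
    refine Submodule.span_le.mpr fun g hg => ?_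
    change (s ^ (∑ g, n g) • y) * g ∈ (1 : Submodule B K)
    rw [← Finset.add_sum_erase _ n (Finset.mem_univ ⟨g, hg⟩), pow_add, mul_comm (s ^ _),
      mul_smul, smul_mul_assoc, smul_mul_assoc]
    exact Submodule.smul_mem _ _ (hn ⟨g, hg⟩)
  have e := h1 ⟨s, hs⟩
  rw [← Submodule.span_mul_span] at e
  exact Submodule.mul_saturation_le s _ _
    (mul_le_mul' (Submodule.span_le.mpr (hF _)) hle e)

end Saturation

namespace SingularFoliation

section Local

variable {k : Type v} {K : Type u} [Field k] [Field K] [Algebra k K] (L : SingularFoliation k K)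
  {r : ℕ} (δ : Module.Basis (Fin r) K L.space)

lemma jac_subset {R A : Type u} [CommRing R] [CommRing A] [Algebra R K] [Algebra A K]
    (hRA : ∀ a : R, ∃ b : A, algebraMap A K b = algebraMap R K a) {J : Submodule R K}
    {J' : Submodule A K} (h : ∀ x ∈ J, x ∈ J') {x : K} (hx : x ∈ L.jac δ J) :
    x ∈ L.jac δ J' := by
  induction hx using Submodule.span_induction with
  | mem x hx =>
    obtain ⟨f, rfl⟩ := hx
    exact L.det_mem_jac δ fun i => h _ (f i).2
  | zero => exact zero_mem _
  | add x y _ _ hx hy => exact add_mem hx hy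
  | smul a x _ hx =>
    obtain ⟨b, hb⟩ := hRA a
    rw [Algebra.smul_def, ← hb, ← Algebra.smul_def]
    exact Submodule.smul_mem _ b hx

/-- The formation of `𝒥(A)` commutes with localization. -/
lemma jac_one_of_isLocalized {B C : Subalgebra k K} (hBC : B ≤ C) {s : K} (hs : s ≠ 0)
    (hsB : s ∈ B) (hsC : s⁻¹ ∈ C) (hC : ∀ x ∈ C, ∃ n : ℕ, s ^ n * x ∈ B) :
    L.jac δ (1 : Submodule C K) =
      Submodule.span C (L.jac δ (1 : Submodule B K) : Set K) := by
  refine le_antisymm (L.jac_le δ fun f hf => ?_) (Submodule.span_le.mpr ?_)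
  · have h1 : ∀ i, ∃ n : ℕ, s ^ n * f i ∈ B := fun i => by
      obtain ⟨c, hc⟩ := Submodule.mem_one.mp (hf i)
      exact hC _ (hc ▸ c.2)
    choose n hn using h1
    have h2 : ∀ i, s ^ (∑ i, n i) * f i ∈ (1 : Submodule B K) := fun i => by
      rw [← Finset.sum_erase_add _ n (Finset.mem_univ i), pow_add, mul_assoc]
      exact Submodule.mem_one.mpr ⟨⟨_, B.mul_mem (B.pow_mem hsB _) (hn i)⟩, rfl⟩
    have h3 := L.det_mem_jac δ h2
    rw [det_rowMatrix_mul] at h3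
    have h4 : (L.rowMatrix δ f).det = (s⁻¹ ^ (∑ i, n i)) ^ (r + 1) *
        ((s ^ (∑ i, n i)) ^ (r + 1) * (L.rowMatrix δ f).det) := by
      rw [← mul_assoc, ← mul_pow, ← mul_pow, inv_mul_cancel₀ hs, one_pow, one_pow, one_mul]
    rw [h4]
    exact Submodule.smul_mem _ (⟨_, C.pow_mem (C.pow_mem hsC _) _⟩ : C)
      (Submodule.subset_span h3)
  · refine fun x hx => L.jac_subset δ (fun b => ⟨⟨b, hBC b.2⟩, rfl⟩) (fun y hy => ?_) hx
    obtain ⟨b, rfl⟩ := Submodule.mem_one.mp hy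
    exact Submodule.mem_one.mpr ⟨⟨b, hBC b.2⟩, rfl⟩

/-- If `𝒥(C)` is invertible for localizations `C` of `B` which cover `Spec B`, then `𝒥(B)` is
invertible. -/
lemma isUnit_jac_one_of_local {B : Subalgebra k K} {S : Set B} (hS : Ideal.span S = ⊤)
    (h : ∀ s ∈ S, (s : K) ≠ 0 ∧ ∃ C : Subalgebra k K, B ≤ C ∧ (s : K)⁻¹ ∈ C ∧
      (∀ x ∈ C, ∃ n : ℕ, (s : K) ^ n * x ∈ B) ∧ IsUnit (L.jac δ (1 : Submodule C K))) :
    IsUnit (L.jac δ (1 : Submodule B K)) := by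
  refine Submodule.isUnit_of_local hS fun s hs => ?_
  obtain ⟨hs0, C, hBC, hsC, hC, hu⟩ := h s hs
  rw [L.jac_one_of_isLocalized δ hBC hs0 s.2 hsC hC] at hu
  set T := L.jac δ (1 : Submodule B K)
  obtain ⟨T', hT'⟩ := hu.exists_right_inv
  let T'' : Submodule B K :=
    { T'.toAddSubmonoid with
      smul_mem' := fun b x hx => T'.smul_mem (⟨b, hBC b.2⟩ : C) hx }
  refine ⟨T'', ?_, Submodule.mul_le.mpr fun t ht y hy => ?_⟩
  · have key : ∀ x ∈ Submodule.span C (T : Set K) * T', x ∈ T * T'' := fun x hx => by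
      induction hx using Submodule.mul_induction_on' with
      | add x _ y _ hx hy => exact add_mem hx hy
      | mem_mul_mem a ha b hb =>
        induction ha using Submodule.span_induction generalizing b with
        | mem a ha => exact Submodule.mul_mem_mul ha hb
        | zero => rw [zero_mul]; exact zero_mem _
        | add x y _ _ hx hy => rw [add_mul]; exact add_mem (hx b hb) (hy b hb)
        | smul c x _ hx =>
          rw [smul_mul_assoc, ← mul_smul_comm]
          exact hx _ (T'.smul_mem c hb)
    exact key 1 (hT'.ge (Submodule.one_le.mp le_rfl))
  · have h1 : t * y ∈ (1 : Submodule C K) :=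
      hT'.le (Submodule.mul_mem_mul (Submodule.subset_span ht) hy)
    obtain ⟨c, hc⟩ := Submodule.mem_one.mp h1
    obtain ⟨n, hn⟩ := hC c c.2
    refine ⟨n, Submodule.mem_one.mpr ⟨⟨_, hn⟩, ?_⟩⟩
    rw [← hc]
    rfl

end Local

end SingularFoliation

/-! ### Charts of blowups -/

section Charts

variable {k : Type v} {R K : Type u} [Field k] [Field K] [Algebra k K] [CommRing R] [Algebra R K]

/-- The subring `A` is the affine chart `R[f⁻¹ J] = ⋃ f⁻ⁿ Jⁿ` of the blowup along `J`. -/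
def IsBlowupChart (A : Subalgebra k K) (J : Submodule R K) (f : K) : Prop :=
  ∀ x, x ∈ A ↔ ∃ n : ℕ, f ^ n * x ∈ J ^ n

lemma inv_mul_mem_imp_algebraMap_mem {B : Subring K} {J : Submodule R K} {f : K} (hf : f ∈ J)
    (hf0 : f ≠ 0) (h : ∀ j ∈ J, f⁻¹ * j ∈ B) (a : R) : algebraMap R K a ∈ B := by
  have := h _ (J.smul_mem a hf)
  rwa [Algebra.smul_def, mul_left_comm, inv_mul_cancel₀ hf0, mul_one] at this

/-- The chart `R[f⁻¹ J]` is the smallest subring containing `f⁻¹ J`. -/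
lemma inv_pow_mul_mem {B : Subring K} {J : Submodule R K} {f : K} (hf : f ∈ J) (hf0 : f ≠ 0)
    (h : ∀ j ∈ J, f⁻¹ * j ∈ B) {n : ℕ} {y : K} (hy : y ∈ J ^ n) : f⁻¹ ^ n * y ∈ B := by
  induction hy using Submodule.pow_induction_on_left' with
  | algebraMap a => simpa using inv_mul_mem_imp_algebraMap_mem hf hf0 h a
  | add x y i _ _ hx hy => rw [mul_add]; exact B.add_mem hx hy
  | mem_mul m hm i x _ hx =>
    rw [pow_succ', mul_mul_mul_comm]
    exact B.mul_mem (h m hm) hx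

namespace IsBlowupChart

variable {A : Subalgebra k K} {J : Submodule R K} {f : K}

lemma inv_mul_mem (hA : IsBlowupChart A J f) (hf0 : f ≠ 0) {j : K} (hj : j ∈ J) :
    f⁻¹ * j ∈ A :=
  (hA _).mpr ⟨1, by rwa [pow_one, pow_one, mul_inv_cancel_left₀ hf0]⟩

lemma algebraMap_mem (hA : IsBlowupChart A J f) (hf : f ∈ J) (hf0 : f ≠ 0) (a : R) :
    algebraMap R K a ∈ A :=
  inv_mul_mem_imp_algebraMap_mem (B := A.toSubring) hf hf0 (fun _ hj => hA.inv_mul_mem hf0 hj) a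

lemma span_eq (hA : IsBlowupChart A J f) (hf : f ∈ J) (hf0 : f ≠ 0) :
    Submodule.span A (J : Set K) = Submodule.span A {f} := by
  refine le_antisymm (Submodule.span_le.mpr fun j hj => ?_) (Submodule.span_mono (by simpa))
  refine Submodule.mem_span_singleton.mpr ⟨⟨_, hA.inv_mul_mem hf0 hj⟩, ?_⟩
  change f⁻¹ * j * f = j
  rw [mul_right_comm, inv_mul_cancel₀ hf0, one_mul]

lemma isFractionRing [IsDomain R] [IsFractionRing R K] (hA : IsBlowupChart A J f) (hf : f ∈ J)
    (hf0 : f ≠ 0) : IsFractionRing A K :=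
  IsFractionRing.of_field _ _ fun z => by
    obtain ⟨a, b, -, rfl⟩ := IsFractionRing.div_surjective (A := R) z
    exact ⟨⟨_, hA.algebraMap_mem hf hf0 a⟩, ⟨_, hA.algebraMap_mem hf hf0 b⟩, rfl⟩

variable (L : SingularFoliation k K) {r : ℕ} (δ : Module.Basis (Fin r) K L.space)

/-- On the chart `A = R[f⁻¹ J]` the module `𝒥(J)` generates `f ^ (r + 1) 𝒥(A)`. -/
lemma span_jac [CharZero k] (hA : IsBlowupChart A J f) (hf : f ∈ J) (hf0 : f ≠ 0) :
    Submodule.span A (L.jac δ J : Set K) =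
      Submodule.span A {f} ^ (r + 1) * L.jac δ (1 : Submodule A K) := by
  rw [← L.jac_eq_of_isUnit δ (Submodule.isUnit_span_singleton hf0)]
  refine le_antisymm (Submodule.span_le.mpr fun x hx => ?_) ?_
  · refine L.jac_subset δ (fun a => ⟨⟨_, hA.algebraMap_mem hf hf0 a⟩, rfl⟩) (fun j hj => ?_) hx
    rw [← hA.span_eq hf hf0]
    exact Submodule.subset_span hj
  · refine L.jac_le_of_jet_mem_span δ (S := J) (fun x hx => ?_)
      fun g hg => Submodule.subset_span (L.det_mem_jac δ hg)
    obtain ⟨⟨a, ha⟩, rfl⟩ := Submodule.mem_span_singleton.mp hx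
    change L.jet δ (a * f) ∈ _
    have key : ∀ (n : ℕ) (y : K), y ∈ J ^ n →
        L.jet δ (f⁻¹ ^ n * y * f) ∈ Submodule.span A (L.jet δ '' J) := by
      intro n y hy
      have hmem : ∀ {n : ℕ} {y : K}, y ∈ J ^ n → f⁻¹ ^ n * y ∈ A := fun hy =>
        inv_pow_mul_mem (B := A.toSubring) hf hf0 (fun _ hj => hA.inv_mul_mem hf0 hj) hy
      have hsmul : ∀ {c : K}, c ∈ A → ∀ {w}, w ∈ Submodule.span A (L.jet δ '' J) →
          c • w ∈ Submodule.span A (L.jet δ '' J) := fun hc _ hw =>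
        Submodule.smul_mem _ (⟨_, hc⟩ : A) hw
      induction hy using Submodule.pow_induction_on_left' with
      | algebraMap a =>
        refine Submodule.subset_span ⟨_, ?_, rfl⟩
        rw [pow_zero, one_mul, ← Algebra.smul_def]
        exact J.smul_mem a hf
      | add x y i _ _ hx hy =>
        rw [mul_add, add_mul, map_add]
        exact add_mem hx hy
      | mem_mul m hm i x hx ih =>
        have hm' : L.jet δ (f⁻¹ * m * f) ∈ Submodule.span A (L.jet δ '' J) := by
          refine Submodule.subset_span ⟨m, hm, ?_⟩
          rw [mul_right_comm, inv_mul_cancel₀ hf0, one_mul]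
        rw [pow_succ', mul_mul_mul_comm, SingularFoliation.jet_mul_mul]
        exact sub_mem (add_mem (hsmul (hA.inv_mul_mem hf0 hm) ih) (hsmul (hmem hx) hm'))
          (hsmul (A.mul_mem (hA.inv_mul_mem hf0 hm) (hmem hx))
            (Submodule.subset_span ⟨f, hf, rfl⟩))
    obtain ⟨n, hn⟩ := (hA a).mp ha
    have := key n _ hn
    rwa [← mul_assoc, ← mul_pow, inv_mul_cancel₀ hf0, one_pow, one_mul] at this

/-- If `𝒥(A)` is invertible for the chart `A = R[f⁻¹ J]` then `𝒥(J 𝒥(J))` and `𝒥(J)^(r+2)` generate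
the same `A`-module, so that elements of the former lie in the latter after multiplication by a
power of `J`. -/
lemma exists_pow_mul_mem [CharZero k] (hA : IsBlowupChart A J f) (hf : f ∈ J) (hf0 : f ≠ 0)
    (hu : IsUnit (L.jac δ (1 : Submodule A K))) {x : K} (hx : x ∈ L.jac δ (J * L.jac δ J)) :
    ∃ n : ℕ, f ^ n * x ∈ J ^ n * L.jac δ J ^ (r + 2) := by
  have hfu := Submodule.isUnit_span_singleton (A := A) hf0
  have h1 : x ∈ L.jac δ (Submodule.span A ((J * L.jac δ J : Submodule R K) : Set K)) :=
    L.jac_subset δ (fun a => ⟨⟨_, hA.algebraMap_mem hf hf0 a⟩, rfl⟩)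
      (fun _ hj => Submodule.subset_span hj) hx
  rw [Submodule.span_coe_mul, hA.span_eq hf hf0, hA.span_jac L δ hf hf0,
    L.jac_eq_of_isUnit δ (hfu.mul ((hfu.pow _).mul hu)), ← mul_assoc, ← pow_succ', mul_pow,
    mul_assoc, ← pow_succ, ← pow_mul, mul_comm (r + 1 + 1), pow_mul, ← mul_pow,
    ← hA.span_jac L δ hf hf0, ← Submodule.span_coe_pow_succ] at h1
  clear hx
  induction h1 using Submodule.span_induction with
  | mem x hx => exact ⟨0, by simpa using hx⟩
  | zero => exact ⟨0, by simp⟩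
  | add x y _ _ hx hy =>
    obtain ⟨n, hn⟩ := hx
    obtain ⟨m, hm⟩ := hy
    refine ⟨n + m, ?_⟩
    rw [show f ^ (n + m) * (x + y) = f ^ m * (f ^ n * x) + f ^ n * (f ^ m * y) by ring]
    refine add_mem ?_ ?_
    · rw [add_comm n, pow_add J, mul_assoc (J ^ m)]
      exact Submodule.mul_mem_mul (Submodule.pow_mem_pow _ hf _) hn
    · rw [pow_add J, mul_assoc (J ^ n)]
      exact Submodule.mul_mem_mul (Submodule.pow_mem_pow _ hf _) hm
  | smul a x _ hx =>
    obtain ⟨n, hn⟩ := hx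
    obtain ⟨m, hm⟩ := (hA a).mp a.2
    refine ⟨m + n, ?_⟩
    rw [pow_add J, mul_assoc, show f ^ (m + n) * a • x = (f ^ m * a) * (f ^ n * x) by
      rw [Algebra.smul_def]; change f ^ (m + n) * (a * x) = _; ring]
    exact Submodule.mul_mem_mul hm hn

/-- If `J^N 𝒥(J)^(r+2) = J^N 𝒥(J 𝒥(J))` then `𝒥(C)` is invertible for the charts `C` of the blowup
along `J 𝒥(J)`: both `J` and `𝒥(J)` become principal over `C`, and `𝒥(C)` is a factor of the
right hand side. -/
lemma isUnit_jac_one [CharZero k] {C : Subalgebra k K} {h : K}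
    (hC : IsBlowupChart C (J * L.jac δ J) (f * h)) (hf : f ∈ J) (hf0 : f ≠ 0)
    (hh : h ∈ L.jac δ J) (hh0 : h ≠ 0) {N : ℕ}
    (heq : J ^ N * L.jac δ J ^ (r + 2) = J ^ N * L.jac δ (J * L.jac δ J)) :
    IsUnit (L.jac δ (1 : Submodule C K)) := by
  have hfh : f * h ∈ J * L.jac δ J := Submodule.mul_mem_mul hf hh
  have hfh0 : f * h ≠ 0 := mul_ne_zero hf0 hh0
  have hJ : Submodule.span C (J : Set K) = Submodule.span C {f} := by
    refine le_antisymm (Submodule.span_le.mpr fun j hj => ?_) (Submodule.span_mono (by simpa))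
    refine Submodule.mem_span_singleton.mpr
      ⟨⟨_, hC.inv_mul_mem hfh0 (Submodule.mul_mem_mul hj hh)⟩, ?_⟩
    change (f * h)⁻¹ * (j * h) * f = j
    field_simp
  have hI : Submodule.span C (L.jac δ J : Set K) = Submodule.span C {h} := by
    refine le_antisymm (Submodule.span_le.mpr fun j hj => ?_) (Submodule.span_mono (by simpa))
    refine Submodule.mem_span_singleton.mpr
      ⟨⟨_, hC.inv_mul_mem hfh0 (Submodule.mul_mem_mul hf hj)⟩, ?_⟩
    change (f * h)⁻¹ * (f * j) * h = j
    field_simp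
  -- multiplying the equality by `J` avoids the zeroth power
  have heq' : J ^ (N + 1) * L.jac δ J ^ (r + 1 + 1) =
      J ^ (N + 1) * L.jac δ (J * L.jac δ J) := by
    rw [pow_succ', mul_assoc, mul_assoc, heq]
  have e := congrArg (fun P : Submodule R K => Submodule.span C (P : Set K)) heq'
  simp only [Submodule.span_coe_mul, Submodule.span_coe_pow_succ] at e
  rw [hC.span_jac L δ hfh hfh0, hJ, hI] at e
  have hu : IsUnit (Submodule.span C {f} ^ (N + 1) * Submodule.span C {h} ^ (r + 1 + 1)) :=
    ((Submodule.isUnit_span_singleton hf0).pow _).mul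
      ((Submodule.isUnit_span_singleton hh0).pow _)
  rw [e] at hu
  exact isUnit_of_mul_isUnit_right (isUnit_of_mul_isUnit_right hu)

end IsBlowupChart

end Charts

/-! ### Finiteness and the passage to powers of `J` -/

section Finite

variable {k : Type v} {R K : Type u} [Field k] [Field K] [Algebra k K] [CommRing R] [Algebra R K]

lemma SingularFoliation.jac_fg [Algebra k R] [IsScalarTower k R K] [Algebra.FiniteType k R]
    (L : SingularFoliation k K) {r : ℕ} (δ : Module.Basis (Fin r) K L.space) {J : Submodule R K}
    (hJ : J.FG) : (L.jac δ J).FG := by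
  classical
  obtain ⟨G, rfl⟩ := hJ
  obtain ⟨X, hX⟩ := (Algebra.FiniteType.out : (⊤ : Subalgebra k R).FG)
  let S : Finset K := G ∪ Finset.image₂ (fun x g => algebraMap R K x * g) X G
  have hS : (S : Set K) ⊆ Submodule.span R (G : Set K) := by
    intro s hs
    rcases Finset.mem_union.mp hs with hs | hs
    · exact Submodule.subset_span hs
    · obtain ⟨x, -, g, hg, rfl⟩ := Finset.mem_image₂.mp hs
      rw [← Algebra.smul_def]
      exact Submodule.smul_mem _ _ (Submodule.subset_span hg)
  have hjet : ∀ x ∈ Submodule.span R (G : Set K),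
      L.jet δ x ∈ Submodule.span R (L.jet δ '' S) := by
    have h0 : ∀ g ∈ G, L.jet δ g ∈ Submodule.span R (L.jet δ '' S) := fun g hg =>
      Submodule.subset_span ⟨g, Finset.mem_union_left _ hg, rfl⟩
    have h1 : ∀ g ∈ G, ∀ a : R,
        L.jet δ (algebraMap R K a * g) ∈ Submodule.span R (L.jet δ '' S) := by
      intro g hg a
      have ha : a ∈ Algebra.adjoin k (X : Set R) := by rw [hX]; trivial
      induction ha using Algebra.adjoin_induction with
      | mem x hx =>
        exact Submodule.subset_span
          ⟨_, Finset.mem_union_right _ (Finset.mem_image₂_of_mem hx hg), rfl⟩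
      | algebraMap c =>
        rw [← IsScalarTower.algebraMap_apply k R K, ← Algebra.smul_def, map_smul,
          ← algebraMap_smul R c]
        exact Submodule.smul_mem _ _ (h0 g hg)
      | add a b _ _ ha hb => rw [map_add, add_mul, map_add]; exact add_mem ha hb
      | mul a b _ _ ha hb =>
        rw [map_mul (algebraMap R K), SingularFoliation.jet_mul_mul, algebraMap_smul,
          algebraMap_smul, ← map_mul, algebraMap_smul]
        exact sub_mem (add_mem (Submodule.smul_mem _ _ hb) (Submodule.smul_mem _ _ ha))
          (Submodule.smul_mem _ _ (h0 g hg))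
    have h2 : ∀ x ∈ Submodule.span R (G : Set K), ∀ a : R,
        L.jet δ (algebraMap R K a * x) ∈ Submodule.span R (L.jet δ '' S) := by
      intro x hx
      induction hx using Submodule.span_induction with
      | mem x hx => exact h1 x hx
      | zero => intro a; rw [mul_zero, map_zero]; exact zero_mem _
      | add x y _ _ hx hy => intro a; rw [mul_add, map_add]; exact add_mem (hx a) (hy a)
      | smul b x _ hx =>
        intro a
        rw [Algebra.smul_def, ← mul_assoc, ← map_mul]
        exact hx _
    intro x hx
    simpa using h2 x hx 1
  let T : Set K := Set.range fun f : Fin (r + 1) → S => (L.rowMatrix δ fun i => (f i : K)).det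
  refine ⟨(Set.finite_range _ : T.Finite).toFinset, ?_⟩
  rw [Set.Finite.coe_toFinset]
  refine le_antisymm (Submodule.span_le.mpr ?_) (L.jac_le_of_jet_mem_span δ hjet fun f hf => ?_)
  · rintro _ ⟨f, rfl⟩
    exact L.det_mem_jac δ fun i => hS (f i).2
  · exact Submodule.subset_span ⟨fun i => ⟨f i, hf i⟩, rfl⟩

/-- If every generator of `J` has a power multiplying `Q` into `Jⁿ P`, then `J ^ N Q ≤ J ^ N P` for
large `N`. -/
lemma Submodule.exists_pow_mul_le_pow_mul {G : Finset K} {J P Q : Submodule R K}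
    (hGJ : Submodule.span R (G : Set K) ≤ J)
    (h : ∀ f ∈ G, ∃ n : ℕ, Submodule.span R {f} ^ n * Q ≤ J ^ n * P) :
    ∃ N : ℕ, Submodule.span R (G : Set K) ^ N * Q ≤ J ^ N * P := by
  classical
  induction G using Finset.induction_on with
  | empty => exact ⟨1, by simp⟩
  | insert a s _ ih =>
    rw [Finset.coe_insert, Submodule.span_insert, sup_le_iff] at hGJ
    obtain ⟨m, hm⟩ := ih hGJ.2 fun f hf => h f (Finset.mem_insert_of_mem hf)
    obtain ⟨n, hn⟩ := h a (Finset.mem_insert_self a s)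
    rw [Finset.coe_insert, Submodule.span_insert]
    generalize Submodule.span R {a} = H at hGJ hn
    generalize Submodule.span R (s : Set K) = H' at hGJ hm
    have hcast : ∀ c : ℕ, (c : Submodule R K) ≤ 1 := fun c => by
      induction c with
      | zero => rw [Nat.cast_zero]; exact bot_le
      | succ c ih => rw [Nat.cast_succ]; exact sup_le ih le_rfl
    refine ⟨n + m, ?_⟩
    rw [← Submodule.add_eq_sup, add_pow, Finset.sum_mul]
    refine Finset.sum_induction _ (· ≤ J ^ (n + m) * P) (fun _ _ => sup_le) bot_le fun i hi => ?_
    rw [Finset.mem_range] at hi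
    calc H ^ i * H' ^ (n + m - i) * ((n + m).choose i : Submodule R K) * Q
        ≤ H ^ i * H' ^ (n + m - i) * Q := by
          refine mul_le_mul' ?_ le_rfl
          exact (mul_le_mul' le_rfl (hcast _)).trans (mul_one _).le
      _ ≤ J ^ (n + m) * P := by
        by_cases hin : n ≤ i
        · obtain ⟨j, rfl⟩ := Nat.exists_eq_add_of_le hin
          calc H ^ (n + j) * H' ^ (n + m - (n + j)) * Q
              = H ^ j * H' ^ (n + m - (n + j)) * (H ^ n * Q) := by ring
            _ ≤ J ^ j * J ^ (n + m - (n + j)) * (J ^ n * P) :=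
              mul_le_mul' (mul_le_mul' (pow_le_pow_left' hGJ.1 _) (pow_le_pow_left' hGJ.2 _)) hn
            _ = J ^ (n + m) * P := by
              rw [← mul_assoc, ← pow_add, ← pow_add]
              congr 2
              omega
        · obtain ⟨j, hj⟩ := Nat.exists_eq_add_of_le (show m ≤ n + m - i by omega)
          calc H ^ i * H' ^ (n + m - i) * Q = H ^ i * H' ^ j * (H' ^ m * Q) := by rw [hj]; ring
            _ ≤ J ^ i * J ^ j * (J ^ m * P) :=
              mul_le_mul' (mul_le_mul' (pow_le_pow_left' hGJ.1 _) (pow_le_pow_left' hGJ.2 _)) hm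
            _ = J ^ (n + m) * P := by
              rw [← mul_assoc, ← pow_add, ← pow_add]
              congr 2
              omega

/-- For finitely generated `J` and `Q`, an inclusion `Q ⊆ f⁻ⁿ Jⁿ P` on every chart of the blowup
along `J` yields `J ^ N Q ≤ J ^ N P`. -/
lemma Submodule.exists_pow_mul_le_of_local {J P Q : Submodule R K} (hJ : J.FG) (hQ : Q.FG)
    (h : ∀ f ∈ J, f ≠ 0 → ∀ x ∈ Q, ∃ n : ℕ, f ^ n * x ∈ J ^ n * P) :
    ∃ N : ℕ, J ^ N * Q ≤ J ^ N * P := by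
  classical
  obtain ⟨G, rfl⟩ := hJ
  refine Submodule.exists_pow_mul_le_pow_mul le_rfl fun f hf => ?_
  rcases eq_or_ne f 0 with rfl | hf0
  · exact ⟨1, by simp⟩
  obtain ⟨X, rfl⟩ := hQ
  have hfG : f ∈ Submodule.span R (G : Set K) := Submodule.subset_span hf
  choose n hn using fun x : X => h f hfG hf0 x (Submodule.subset_span x.2)
  refine ⟨∑ x, n x, ?_⟩
  rw [Submodule.span_pow, Set.singleton_pow, Submodule.span_mul_span, Submodule.span_le]
  rintro _ ⟨_, rfl, x, hx, rfl⟩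
  change f ^ (∑ x, n x) * x ∈ _
  rw [← Finset.sum_erase_add _ n (Finset.mem_univ ⟨x, hx⟩), pow_add, pow_add, mul_assoc, mul_assoc]
  exact Submodule.mul_mem_mul (Submodule.pow_mem_pow _ hfG _) (hn ⟨x, hx⟩)

end Finite

/-! ### Models with a dense generic point -/

namespace GenericModel

variable {R K : Type u} [CommRing R] [Field K] [Algebra R K] (M : GenericModel R K)

lemma le_preimage_gen_of_mem {U : M.X.Opens} {x : Spec (CommRingCat.of K)} (hx : M.gen x ∈ U) :
    ⊤ ≤ M.gen ⁻¹ᵁ U := by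
  intro y _
  have : y = x := Subsingleton.elim (α := PrimeSpectrum K) y x
  subst this
  exact hx

lemma le_preimage_gen [IsDominant M.gen] {U : M.X.Opens} (hU : U ≠ ⊥) : ⊤ ≤ M.gen ⁻¹ᵁ U := by
  have hne : (U : Set M.X).Nonempty := by
    rw [Set.nonempty_iff_ne_empty]
    exact fun h => hU (TopologicalSpace.Opens.ext h)
  obtain ⟨y, hy⟩ := M.gen.denseRange.exists_mem_open U.2 hne
  exact M.le_preimage_gen_of_mem hy

lemma toK_res {U V : M.X.Opens} (hVU : V ≤ U) (hV : ⊤ ≤ M.gen ⁻¹ᵁ V) (hU : ⊤ ≤ M.gen ⁻¹ᵁ U)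
    (s : Γ(M.X, U)) :
    M.toK V hV ((M.X.presheaf.map (homOfLE hVU).op).hom s) = M.toK U hU s := by
  have : M.X.presheaf.map (homOfLE hVU).op ≫ M.gen.appLE V ⊤ hV = M.gen.appLE U ⊤ hU :=
    M.gen.map_appLE hV _
  have := congr($(this).hom s)
  simp only [toK, CommRingCat.hom_comp, RingHom.comp_apply] at this ⊢
  rw [this]

lemma toK_appLE {M N : GenericModel R K} (φ : M.X ⟶ N.X) (hφ : M.gen ≫ φ = N.gen)
    {U : N.X.Opens} {V : M.X.Opens} (hVU : V ≤ φ ⁻¹ᵁ U) (hV : ⊤ ≤ M.gen ⁻¹ᵁ V)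
    (hU : ⊤ ≤ N.gen ⁻¹ᵁ U) (s : Γ(N.X, U)) :
    M.toK V hV ((φ.appLE U V hVU).hom s) = N.toK U hU s := by
  have : φ.appLE U V hVU ≫ M.gen.appLE V ⊤ hV = N.gen.appLE U ⊤ hU := by
    rw [Scheme.Hom.appLE_comp_appLE]
    simp only [hφ]
  have := congr($(this).hom s)
  simp only [toK, CommRingCat.hom_comp, RingHom.comp_apply] at this ⊢
  rw [this]

lemma toK_eq_zero_iff {U : M.X.Opens} (hU : ⊤ ≤ M.gen ⁻¹ᵁ U) (s : Γ(M.X, U)) :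
    M.toK U hU s = 0 ↔ ¬ (⊤ ≤ M.gen ⁻¹ᵁ M.X.basicOpen s) := by
  have h1 : M.toK U hU s = 0 ↔ (M.gen.appLE U ⊤ hU).hom s = 0 := by
    have hinj : Function.Injective (Scheme.ΓSpecIso (CommRingCat.of K)).hom.hom :=
      (ConcreteCategory.bijective_of_isIso (Scheme.ΓSpecIso (CommRingCat.of K)).hom).1
    simp only [toK, CommRingCat.hom_comp, RingHom.comp_apply]
    exact map_eq_zero_iff _ hinj
  have h2 := Scheme.basicOpen_appLE M.gen ⊤ U hU s
  rw [top_inf_eq] at h2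
  rw [h1, ← h2, ← AlgebraicGeometry.basicOpen_eq_bot_iff, top_le_iff]
  change (Spec (CommRingCat.of K)).basicOpen ((M.gen.appLE U ⊤ hU).hom s) = ⊥ ↔
    ¬ (Spec (CommRingCat.of K)).basicOpen ((M.gen.appLE U ⊤ hU).hom s) = ⊤
  have : Nontrivial (TopologicalSpace.Opens (Spec (CommRingCat.of K))) := inferInstance
  constructor
  · intro h; rw [h]; exact bot_ne_top
  · intro h
    by_contra hb
    apply h
    ext y
    have hne : ((Spec (CommRingCat.of K)).basicOpen ((M.gen.appLE U ⊤ hU).hom s) :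
        Set (Spec (CommRingCat.of K))).Nonempty := by
      rw [Set.nonempty_iff_ne_empty]
      exact fun h => hb (TopologicalSpace.Opens.ext h)
    obtain ⟨x, hx⟩ := hne
    have : y = x := Subsingleton.elim (α := PrimeSpectrum K) y x
    subst this
    exact ⟨fun _ => trivial, fun _ => hx⟩

lemma toK_injective [IsReduced M.X] [IsDominant M.gen] {U : M.X.Opens}
    (hU : ⊤ ≤ M.gen ⁻¹ᵁ U) : Function.Injective (M.toK U hU) := by
  refine (injective_iff_map_eq_zero _).mpr fun s hs => ?_
  rw [toK_eq_zero_iff] at hs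
  by_contra h0
  refine hs (M.le_preimage_gen fun hb => h0 ?_)
  exact (AlgebraicGeometry.basicOpen_eq_bot_iff s).mp hb

lemma gen_eq {U : M.X.Opens} (hU : ⊤ ≤ M.gen ⁻¹ᵁ U) (ha : IsAffineOpen U) :
    M.gen = Spec.map (CommRingCat.ofHom (M.toK U hU)) ≫ ha.fromSpec := by
  have h := ha.SpecMap_appLE_fromSpec M.gen (isAffineOpen_top (Spec (CommRingCat.of K))) hU
  rw [IsAffineOpen.fromSpec_top] at h
  have e : CommRingCat.ofHom (M.toK U hU) =
    M.gen.appLE U ⊤ hU ≫ (Scheme.ΓSpecIso (CommRingCat.of K)).hom := rfl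
  rw [e, Spec.map_comp, Category.assoc, h, ← Category.assoc]
  convert! (Category.id_comp _).symm
  rw [Scheme.isoSpec_Spec_inv, ← Spec.map_comp, Iso.inv_hom_id, Spec.map_id]

/-- If the generic point factors through an open subscheme then it is dense there. -/
lemma isDominant_of_isDominant_comp_ι [IsDominant M.gen] {V : Scheme.{u}} (i : V ⟶ M.X)
    [IsOpenImmersion i] (g : Spec (CommRingCat.of K) ⟶ V) (hg : g ≫ i = M.gen) :
    IsDominant g := by
  have : IsDominant (g ≫ i) := hg ▸ ‹_›
  exact IsDominant.of_comp_of_isOpenImmersion g i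

end GenericModel

/-! ### Charts of `Proj` of a Rees algebra -/

/-- If a homogeneous element `t` becomes invertible then the morphism to `Proj` factors through the
chart `D₊(t)`. -/
lemma AlgebraicGeometry.Proj.fromOfGlobalSections_eq_of_isUnit {σ : Type*} {A : Type u} [CommRing A]
    [SetLike σ A] [AddSubgroupClass σ A] (𝒜 : ℕ → σ) [GradedRing 𝒜] {X : Scheme.{u}}
    (φ : A →+* Γ(X, ⊤)) (hφ : (HomogeneousIdeal.irrelevant 𝒜).toIdeal.map φ = ⊤) {t : A} {d : ℕ}
    (hd : 0 < d) (ht : t ∈ 𝒜 d) (hu : IsUnit (φ t)) :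
    Proj.fromOfGlobalSections 𝒜 φ hφ = X.toSpecΓ ≫ Spec.map (CommRingCat.ofHom
      ((IsLocalization.Away.lift (S := Localization.Away t) t hu).comp
        (algebraMap (HomogeneousLocalization.Away 𝒜 t) (Localization.Away t)))) ≫
      Proj.awayι 𝒜 t ht hd := by
  have htop : X.basicOpen (φ t) = ⊤ := Scheme.basicOpen_of_isUnit X hu
  have : IsIso (X.basicOpen (φ t)).ι := by
    rw [htop, ← Scheme.topIso_hom]
    infer_instance
  rw [← cancel_epi (X.basicOpen (φ t)).ι]
  have h1 := Proj.fromOfGlobalSections_resLE 𝒜 φ hφ hd ht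
  have h2 := (Proj.fromOfGlobalSections 𝒜 φ hφ).resLE_comp_ι
    (Proj.fromOfGlobalSections_preimage_basicOpen 𝒜 φ hφ hd ht).ge
  rw [← h2, h1, Proj.toBasicOpenOfGlobalSections]
  have h3 : (basicOpenIsoSpecAway (R := Γ(X, ⊤)) (φ t)).hom =
      Scheme.Opens.ι (X := Spec Γ(X, ⊤)) (PrimeSpectrum.basicOpen (φ t)) ≫
      Spec.map (CommRingCat.ofHom (IsLocalization.Away.lift (S := Localization.Away (φ t)) (φ t)
        (g := RingHom.id Γ(X, ⊤)) hu)) := by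
    have : Mono (Spec.map (CommRingCat.ofHom
        (algebraMap Γ(X, ⊤) (Localization.Away (φ t))))) := inferInstance
    rw [← cancel_mono (Spec.map (CommRingCat.ofHom
      (algebraMap Γ(X, ⊤) (Localization.Away (φ t))))), basicOpenIsoSpecAway_hom_SpecMap,
      Category.assoc, ← Spec.map_comp, ← CommRingCat.ofHom_comp,
      IsLocalization.Away.lift_comp]
    exact (Category.comp_id _).symm.trans (congrArg _ (Spec.map_id _).symm)
  have h4 : (X.isoOfEq (X.toSpecΓ_preimage_basicOpen (φ t))).inv ≫
      X.toSpecΓ ∣_ PrimeSpectrum.basicOpen (φ t) ≫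
        Scheme.Opens.ι (X := Spec Γ(X, ⊤)) (PrimeSpectrum.basicOpen (φ t)) =
      (X.basicOpen (φ t)).ι ≫ X.toSpecΓ := by
    have h (U : (Spec Γ(X, ⊤)).Opens) (V : X.Opens) (e : X.toSpecΓ ⁻¹ᵁ U = V) :
        (X.isoOfEq e).inv ≫ X.toSpecΓ ∣_ U ≫ U.ι = V.ι ≫ X.toSpecΓ := by
      rw [morphismRestrict_ι, Scheme.isoOfEq_inv, Scheme.homOfLE_ι_assoc]
    exact h _ _ _
  simp only [Category.assoc, h3, reassoc_of% h4, Proj.basicOpenIsoSpec_inv_ι, ← Spec.map_comp_assoc,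
    ← CommRingCat.ofHom_comp]
  congr 5
  rw [← RingHom.comp_assoc]
  congr 1
  refine IsLocalization.ringHom_ext (Submonoid.powers t) ?_
  ext a
  simp

section ReesCharts

variable {R K : Type u} [CommRing R] [Field K] [Algebra R K] (J : Submodule R K)

/-- The degree one element `f X` of the Rees algebra. -/
def reesX {f : K} (hf : f ∈ J) : fracRees J :=
  (fracReesMonomial J 1 f (by rwa [pow_one])).1

lemma reesX_mem {f : K} (hf : f ∈ J) : reesX J hf ∈ fracReesGrading J 1 :=
  (fracReesMonomial J 1 f (by rwa [pow_one])).2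

lemma fracReesEval_monomial {n : ℕ} {x : K} (hx : x ∈ J ^ n) :
    fracReesEval J (fracReesMonomial J n x hx).1 = x := by
  change (Polynomial.monomial n x).eval 1 = x
  simp

lemma fracReesEval_reesX {f : K} (hf : f ∈ J) : fracReesEval J (reesX J hf) = f :=
  fracReesEval_monomial J _

lemma fracReesEval_of_mem {n : ℕ} {p : fracRees J} (hp : p ∈ fracReesGrading J n) :
    fracReesEval J p = p.1.coeff n ∧ p.1 = Polynomial.monomial n (p.1.coeff n) := by
  have h : p.1 = Polynomial.monomial n (p.1.coeff n) := by
    ext m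
    rw [Polynomial.coeff_monomial]
    split_ifs with h
    · rw [h]
    · exact hp m (Ne.symm h)
  refine ⟨?_, h⟩
  change p.1.eval 1 = _
  conv_lhs => rw [h]
  simp

variable {J} {f : K} (hf : f ∈ J) (hf0 : f ≠ 0)

/-- The affine open chart `D₊(f X)` of the blowup. -/
def reesChart : (fracBlowup J).Opens := Proj.basicOpen (fracReesGrading J) (reesX J hf)

lemma isAffineOpen_reesChart : IsAffineOpen (reesChart hf) :=
  Proj.isAffineOpen_basicOpen _ _ (reesX_mem J hf) one_pos

include hf0 in
lemma isUnit_fracReesEval_reesX : IsUnit (fracReesEval J (reesX J hf)) := by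
  rw [fracReesEval_reesX]
  exact hf0.isUnit

/-- The embedding of the coordinate ring of `D₊(f X)` into `K`. -/
def evalAway : HomogeneousLocalization.Away (fracReesGrading J) (reesX J hf) →+* K :=
  (IsLocalization.Away.lift (S := Localization.Away (reesX J hf)) (reesX J hf)
    (isUnit_fracReesEval_reesX hf hf0)).comp (algebraMap _ _)

lemma evalAway_mk (n : ℕ) (p : fracRees J) (hp : p ∈ fracReesGrading J (n • 1)) :
    evalAway hf hf0 (HomogeneousLocalization.Away.mk _ (reesX_mem J hf) n p hp) =
      f⁻¹ ^ n * fracReesEval J p := by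
  have h : IsLocalization.Away.lift (S := Localization.Away (reesX J hf)) (reesX J hf)
      (isUnit_fracReesEval_reesX hf hf0) (Localization.mk p ⟨reesX J hf ^ n, n, rfl⟩) *
      (fracReesEval J (reesX J hf)) ^ n = fracReesEval J p := by
    rw [← map_pow, ← IsLocalization.Away.lift_eq (S := Localization.Away (reesX J hf)) (reesX J hf)
      (isUnit_fracReesEval_reesX hf hf0) (reesX J hf ^ n), ← map_mul, Localization.mk_eq_mk',
      ← IsLocalization.Away.lift_eq (S := Localization.Away (reesX J hf)) (reesX J hf)
      (isUnit_fracReesEval_reesX hf hf0) p]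
    congr 1
    exact IsLocalization.mk'_spec _ p (⟨reesX J hf ^ n, n, rfl⟩ : Submonoid.powers (reesX J hf))
  rw [fracReesEval_reesX] at h
  rw [← h, mul_comm, mul_assoc, ← mul_pow, mul_inv_cancel₀ hf0, one_pow, mul_one]
  rfl

lemma evalAway_injective : Function.Injective (evalAway hf hf0) := by
  refine (injective_iff_map_eq_zero _).mpr fun z hz => ?_
  obtain ⟨n, p, hp, rfl⟩ := HomogeneousLocalization.Away.mk_surjective _ (reesX_mem J hf) z
  rw [evalAway_mk] at hz
  have h0 := (mul_eq_zero.mp hz).resolve_left (pow_ne_zero _ (inv_ne_zero hf0))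
  obtain ⟨h1, h2⟩ := fracReesEval_of_mem J hp
  rw [h1] at h0
  have hp0 : p = 0 := Subtype.ext (by rw [h2, h0, map_zero]; rfl)
  exact HomogeneousLocalization.mk_eq_zero_of_num _ (Subtype.ext hp0)

lemma mem_range_evalAway {x : K} :
    (∃ z, evalAway hf hf0 z = x) ↔ ∃ n : ℕ, f ^ n * x ∈ J ^ n := by
  constructor
  · rintro ⟨z, rfl⟩
    obtain ⟨n, p, hp, rfl⟩ := HomogeneousLocalization.Away.mk_surjective _ (reesX_mem J hf) z
    refine ⟨n, ?_⟩
    rw [evalAway_mk, ← mul_assoc, ← mul_pow, mul_inv_cancel₀ hf0, one_pow, one_mul,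
      (fracReesEval_of_mem J hp).1, smul_eq_mul, mul_one]
    exact p.2 n
  · rintro ⟨n, hn⟩
    refine ⟨HomogeneousLocalization.Away.mk _ (reesX_mem J hf) n (fracReesMonomial J n _ hn).1
      (by rw [smul_eq_mul, mul_one]; exact (fracReesMonomial J n _ hn).2), ?_⟩
    rw [evalAway_mk, fracReesEval_monomial, ← mul_assoc, ← mul_pow, inv_mul_cancel₀ hf0, one_pow,
      one_mul]

/-- The inclusion of the chart `D₊(f X)`. -/
def reesChartι : Spec (CommRingCat.of (HomogeneousLocalization.Away (fracReesGrading J)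
    (reesX J hf))) ⟶ fracBlowup J :=
  Proj.awayι (fracReesGrading J) (reesX J hf) (reesX_mem J hf) one_pos

instance : IsOpenImmersion (reesChartι hf) :=
  inferInstanceAs (IsOpenImmersion (Proj.awayι _ _ _ _))

lemma opensRange_reesChartι : (reesChartι hf).opensRange = reesChart hf :=
  Proj.opensRange_awayι _ _ _ _

/-- The generic point of the blowup lies on each chart, where it is given by the embedding of
the coordinate ring into `K`. -/
lemma fracBlowupGen_eq (hJ : J ≠ ⊥) :
    fracBlowupGen J hJ = Spec.map (CommRingCat.ofHom (evalAway hf hf0)) ≫ reesChartι hf := by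
  have hu : IsUnit (((Scheme.ΓSpecIso (CommRingCat.of K)).inv.hom.comp (fracReesEval J))
      (reesX J hf)) := by
    rw [RingHom.comp_apply]
    exact (isUnit_fracReesEval_reesX hf hf0).map _
  rw [fracBlowupGen, Proj.fromOfGlobalSections_eq_of_isUnit (fracReesGrading J) _ _ one_pos
    (reesX_mem J hf) hu, ← SpecMap_ΓSpecIso_hom, ← Spec.map_comp_assoc, reesChartι]
  congr 2
  ext z
  change (Scheme.ΓSpecIso (CommRingCat.of K)).hom.hom (_) = _
  have key : ((Scheme.ΓSpecIso (CommRingCat.of K)).hom.hom.comp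
      (IsLocalization.Away.lift (S := Localization.Away (reesX J hf)) (reesX J hf) hu)) =
      IsLocalization.Away.lift (S := Localization.Away (reesX J hf)) (reesX J hf)
    (isUnit_fracReesEval_reesX hf hf0) := by
    refine IsLocalization.ringHom_ext (Submonoid.powers (reesX J hf)) ?_
    ext a
    simp only [RingHom.comp_apply, IsLocalization.Away.lift_eq]
    exact congr($((Scheme.ΓSpecIso (CommRingCat.of K)).inv_hom_id).hom (fracReesEval J a))
  exact congr($key (algebraMap _ _ z))

end ReesCharts

/-! ### The blowup as a model -/

namespace GenericModel

variable {R K : Type u} [CommRing R] [Field K] [Algebra R K] (M : GenericModel R K)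

lemma le_preimage_gen_of_eq {A : Type u} [CommRing A] (e : A →+* K)
    (i : Spec (CommRingCat.of A) ⟶ M.X) [IsOpenImmersion i]
    (hgen : M.gen = Spec.map (CommRingCat.ofHom e) ≫ i) : ⊤ ≤ M.gen ⁻¹ᵁ i.opensRange := by
  intro y _
  change M.gen y ∈ i.opensRange
  rw [hgen, Scheme.Hom.comp_apply]
  exact ⟨_, rfl⟩

/-- The sections over an affine open subset given by a chart through which the generic point
factors. -/
lemma range_toK_of_gen_eq {A : Type u} [CommRing A] (e : A →+* K)
    (i : Spec (CommRingCat.of A) ⟶ M.X) [IsOpenImmersion i]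
    (hgen : M.gen = Spec.map (CommRingCat.ofHom e) ≫ i) (hU : ⊤ ≤ M.gen ⁻¹ᵁ i.opensRange) (x : K) :
    (∃ s, M.toK i.opensRange hU s = x) ↔ ∃ a, e a = x := by
  have hi : ⊤ ≤ i ⁻¹ᵁ i.opensRange := fun y _ => ⟨y, rfl⟩
  have hiso : IsIso (i.appLE i.opensRange ⊤ hi) := by
    have : IsIso (i.app i.opensRange) := i.isIso_app _ le_rfl
    have htop : i ⁻¹ᵁ i.opensRange = ⊤ := top_le_iff.mp hi
    rw [Scheme.Hom.appLE, show (homOfLE hi) = eqToHom htop.symm from rfl]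
    infer_instance
  let b := i.appLE i.opensRange ⊤ hi ≫ (Scheme.ΓSpecIso (CommRingCat.of A)).hom
  have hb : Function.Bijective b.hom := ConcreteCategory.bijective_of_isIso b
  have key : M.gen.appLE i.opensRange ⊤ hU ≫ (Scheme.ΓSpecIso (CommRingCat.of K)).hom =
      b ≫ CommRingCat.ofHom e := by
    have h1 : M.gen.appLE i.opensRange ⊤ hU =
        i.appLE i.opensRange ⊤ hi ≫ (Spec.map (CommRingCat.ofHom e)).appTop := by
      have hle : (⊤ : (Spec (CommRingCat.of K)).Opens) ≤
        Spec.map (CommRingCat.ofHom e) ⁻¹ᵁ ⊤ := fun _ _ => trivial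
      have : (Spec.map (CommRingCat.ofHom e)).appTop =
          (Spec.map (CommRingCat.ofHom e)).appLE ⊤ ⊤ hle :=
        (Scheme.Hom.appLE_eq_app ..).symm
      rw [this, Scheme.Hom.appLE_comp_appLE]
      simp only [hgen]
    rw [h1, Category.assoc, Scheme.ΓSpecIso_naturality]
    rfl
  have hK : ∀ s, M.toK i.opensRange hU s = e (b.hom s) := fun s => congr($(key).hom s)
  constructor
  · rintro ⟨s, rfl⟩
    exact ⟨_, (hK s).symm⟩
  · rintro ⟨a, rfl⟩
    obtain ⟨s, rfl⟩ := hb.2 a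
    exact ⟨s, hK s⟩

end GenericModel

section BlowupModel

variable {R K : Type u} [CommRing R] [Field K] [Algebra R K] {J : Submodule R K}

/-- The irrelevant ideal of the Rees algebra is generated by `f X`, for `f` in a generating set
of `J`. -/
lemma irrelevant_le_span {G : Set K} (hGJ : G ⊆ J) (hG : (J : Set K) ⊆ Submodule.span R G) :
    (HomogeneousIdeal.irrelevant (fracReesGrading J)).toIdeal ≤
      Ideal.span (Set.range fun g : G => reesX J (hGJ g.2)) := by
  intro p hp
  have h0 : p.1.coeff 0 = 0 := by
    have h1 : ((DirectSum.decompose (fracReesGrading J) p) 0 : fracRees J) = 0 :=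
      (HomogeneousIdeal.mem_irrelevant_iff (fracReesGrading J) p).mp hp
    have h2 := fracRees_coeff_coeAddMonoidHom J (DirectSum.decompose (fracReesGrading J) p) 0
    rw [h1] at h2
    have h3 : DirectSum.coeAddMonoidHom (fracReesGrading J)
        (DirectSum.decompose (fracReesGrading J) p) = p :=
      (DirectSum.decompose (fracReesGrading J)).symm_apply_apply p
    rw [h3] at h2
    simpa using h2
  have h1 : ∀ (j : K) (hj : j ∈ J),
      reesX J hj ∈ Ideal.span (Set.range fun g : G => reesX J (hGJ g.2)) := by
    intro j hj
    have hG' : Submodule.span R G ≤ J := Submodule.span_le.mpr hGJ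
    have H : ∀ x (hx : x ∈ Submodule.span R G),
        reesX J (hG' hx) ∈ Ideal.span (Set.range fun g : G => reesX J (hGJ g.2)) := by
      intro x hx
      induction hx using Submodule.span_induction with
      | mem x hx => exact Ideal.subset_span ⟨⟨x, hx⟩, rfl⟩
      | zero =>
        convert! Ideal.zero_mem _
        exact Subtype.ext (Polynomial.monomial_zero_right 1)
      | add x y hx hy ihx ihy =>
        convert! Ideal.add_mem _ ihx ihy
        exact Subtype.ext (map_add (Polynomial.monomial 1) x y)
      | smul a x hx ih =>
        convert! Ideal.mul_mem_left _ (algebraMap R (fracRees J) a) ih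
        refine Subtype.ext ?_
        rw [← Algebra.smul_def]
        exact (Polynomial.smul_monomial a 1 x).symm
    exact H j (hG hj)
  have h2 : ∀ (n : ℕ) (x : K) (hx : x ∈ J ^ (n + 1)), (fracReesMonomial J (n + 1) x hx).1 ∈
      Ideal.span (Set.range fun g : G => reesX J (hGJ g.2)) := by
    intro n x hx
    have hx' := hx
    rw [pow_succ] at hx'
    induction hx' using Submodule.mul_induction_on' with
    | mem_mul_mem a ha b hb =>
      convert! Ideal.mul_mem_left _ (fracReesMonomial J n a ha).1 (h1 b hb)
      refine Subtype.ext ?_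
      exact (Polynomial.monomial_mul_monomial n 1 a b).symm
    | add x hx' y hy' ihx ihy =>
      convert! Ideal.add_mem _ (ihx (by rwa [pow_succ])) (ihy (by rwa [pow_succ]))
      exact Subtype.ext (map_add (Polynomial.monomial (n + 1)) x y)
  have h3 : p = ∑ i ∈ p.1.support, (fracReesMonomial J i (p.1.coeff i) (p.2 i)).1 := by
    apply Subtype.ext
    rw [AddSubmonoidClass.coe_finsetSum]
    exact p.1.as_sum_support
  rw [h3]
  refine Ideal.sum_mem _ fun i hi => ?_
  rcases i with _ | i
  · exact absurd h0 (Polynomial.mem_support_iff.mp hi)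
  · exact h2 i _ _

/-- The charts `D₊(f X)`, for nonzero `f` in a generating set of `J`, cover the blowup. -/
lemma exists_mem_reesChart {G : Set K} (hGJ : G ⊆ J) (hG : (J : Set K) ⊆ Submodule.span R G)
    (x : fracBlowup J) : ∃ (f : K) (hf : f ∈ G), f ≠ 0 ∧ x ∈ reesChart (hGJ hf) := by
  have h := Proj.iSup_basicOpen_eq_top (fracReesGrading J) _ (irrelevant_le_span hGJ hG)
  obtain ⟨⟨f, hf⟩, hx⟩ := TopologicalSpace.Opens.mem_iSup.mp (h.ge (Set.mem_univ x))
  refine ⟨f, hf, ?_, hx⟩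
  rintro rfl
  have h0 : reesX J (hGJ hf) = 0 := Subtype.ext (Polynomial.monomial_zero_right 1)
  dsimp only at hx
  rw [h0, Proj.basicOpen_zero] at hx
  exact hx

variable (hJ : J ≠ ⊥)

instance {f : K} (hf : f ∈ J) :
    IsOpenImmersion (Y := (blowupModel J hJ).X) (reesChartι hf) :=
  inferInstanceAs (IsOpenImmersion (reesChartι hf))

lemma mem_sections_reesChart {f : K} (hf : f ∈ J) (hf0 : f ≠ 0)
    (h : ⊤ ≤ (blowupModel J hJ).gen ⁻¹ᵁ reesChart hf) (x : K) :
    (∃ s, (blowupModel J hJ).toK (reesChart hf) h s = x) ↔ ∃ n : ℕ, f ^ n * x ∈ J ^ n := by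
  rw [← mem_range_evalAway hf hf0]
  have key : ∀ (U : (blowupModel J hJ).X.Opens) (h : ⊤ ≤ (blowupModel J hJ).gen ⁻¹ᵁ U),
      U = (reesChartι hf).opensRange →
      ((∃ s, (blowupModel J hJ).toK U h s = x) ↔ ∃ a, evalAway hf hf0 a = x) := by
    rintro U h rfl
    exact (blowupModel J hJ).range_toK_of_gen_eq (evalAway hf hf0) (reesChartι hf : _ ⟶ _)
      (fracBlowupGen_eq hf hf0 hJ) h x
  exact key _ h (opensRange_reesChartι hf).symm

lemma le_preimage_gen_reesChart {f : K} (hf : f ∈ J) (hf0 : f ≠ 0) :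
    ⊤ ≤ (blowupModel J hJ).gen ⁻¹ᵁ reesChart hf := by
  have h := (blowupModel J hJ).le_preimage_gen_of_eq (evalAway hf hf0) (reesChartι hf)
    (fracBlowupGen_eq hf hf0 hJ)
  intro y hy
  have := h hy
  change (blowupModel J hJ).gen y ∈ reesChart hf
  rw [← opensRange_reesChartι]
  exact this

instance : IsReduced (fracBlowup J) := by
  let G : Set K := {f | f ∈ J ∧ f ≠ 0}
  have hG : (J : Set K) ⊆ Submodule.span R G := fun f hf => by
    rcases eq_or_ne f 0 with rfl | hf0
    · exact Submodule.zero_mem _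
    · exact Submodule.subset_span ⟨hf, hf0⟩
  let 𝒰 := Proj.affineOpenCoverOfIrrelevantLESpan (fracReesGrading J)
    (fun g : G => reesX J g.2.1) (fun g => reesX_mem J g.2.1) (fun _ => one_pos)
    (irrelevant_le_span (fun f hf => hf.1) hG)
  have h (i : 𝒰.openCover.I₀) : IsReduced (𝒰.openCover.X i) := by
    have := isReduced_of_injective _ (evalAway_injective i.2.1 i.2.2)
    exact inferInstanceAs (IsReduced (Spec (CommRingCat.of
      (HomogeneousLocalization.Away (fracReesGrading J) (reesX J i.2.1)))))
  exact IsReduced.of_openCover _ 𝒰.openCover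

instance : IsDominant (blowupModel J hJ).gen := by
  refine ⟨dense_iff_inter_open.mpr fun O hO ⟨x, hx⟩ => ?_⟩
  obtain ⟨f, hf, hf0, hxf⟩ := exists_mem_reesChart (J := J) (G := (J : Set K)) subset_rfl
    Submodule.subset_span x
  rw [← opensRange_reesChartι] at hxf
  obtain ⟨y, rfl⟩ := hxf
  have hd : DenseRange (Spec.map (CommRingCat.ofHom (evalAway hf hf0))) := by
    refine (PrimeSpectrum.denseRange_comap_iff_ker_le_nilRadical (evalAway hf hf0)).mpr ?_
    rw [(RingHom.injective_iff_ker_eq_bot _).mp (evalAway_injective hf hf0)]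
    exact bot_le
  obtain ⟨z, hz⟩ := hd.exists_mem_open (hO.preimage (reesChartι hf).continuous) ⟨y, hx⟩
  refine ⟨(blowupModel J hJ).gen z, ?_, ⟨z, rfl⟩⟩
  have : (blowupModel J hJ).gen z = reesChartι hf (Spec.map (CommRingCat.ofHom (evalAway hf hf0)) z)
      := by
    rw [← Scheme.Hom.comp_apply, ← fracBlowupGen_eq hf hf0 hJ]
    rfl
  rw [this]
  exact hz

instance : IsSeparated (fracBlowupMap J) := by
  unfold fracBlowupMap
  infer_instance

instance : IsSeparated (blowupModel J hJ).str := inferInstanceAs (IsSeparated (fracBlowupMap J))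

instance : IsReduced (blowupModel J hJ).X := inferInstanceAs (IsReduced (fracBlowup J))

end BlowupModel

/-! ### Morphisms from models to blowups -/

namespace GenericModel

variable {R K : Type u} [CommRing R] [Field K] [Algebra R K] (M : GenericModel R K)

section Opens

variable {U : M.X.Opens} (hU : ⊤ ≤ M.gen ⁻¹ᵁ U)

/-- The generic point of an open subset. -/
def genOpens : Spec (CommRingCat.of K) ⟶ U :=
  IsOpenImmersion.lift U.ι M.gen (by
    rw [Scheme.Opens.range_ι]
    rintro _ ⟨y, rfl⟩
    exact hU (show y ∈ _ from trivial))

lemma genOpens_ι : M.genOpens hU ≫ U.ι = M.gen := IsOpenImmersion.lift_fac _ _ _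

lemma genOpens_toSpecΓ :
    M.genOpens hU ≫ U.toSpecΓ = Spec.map (CommRingCat.ofHom (M.toK U hU)) := by
  have h1 := Scheme.Opens.toSpecΓ_SpecMap_appLE M.gen U ⊤ hU
  have h2 : M.gen.resLE U ⊤ hU = (⊤ : (Spec (CommRingCat.of K)).Opens).ι ≫ M.genOpens hU := by
    rw [← cancel_mono U.ι, Scheme.Hom.resLE_comp_ι, Category.assoc, genOpens_ι]
  rw [h2, Scheme.Opens.toSpecΓ_top, Category.assoc, Category.assoc] at h1
  have : IsIso (⊤ : (Spec (CommRingCat.of K)).Opens).ι := by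
    rw [← Scheme.topIso_hom]
    infer_instance
  rw [cancel_epi, ← SpecMap_ΓSpecIso_hom, ← Spec.map_comp] at h1
  exact h1.symm

instance [IsDominant M.gen] : IsDominant (M.genOpens hU) :=
  M.isDominant_of_isDominant_comp_ι U.ι _ (M.genOpens_ι hU)

lemma evalAway_mem_range {J : Submodule R K} {f : K} (hf : f ∈ J) (hf0 : f ≠ 0)
    (hUJ : ∀ j ∈ J, f⁻¹ * j ∈ Set.range (M.toK U hU)) (z) :
    evalAway hf hf0 z ∈ Set.range (M.toK U hU) := by
  obtain ⟨n, hn⟩ := (mem_range_evalAway hf hf0).mp ⟨z, rfl⟩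
  have := inv_pow_mul_mem (B := (M.toK U hU).range) hf hf0 hUJ hn
  rwa [← mul_assoc, ← mul_pow, inv_mul_cancel₀ hf0, one_pow, one_mul] at this

variable [IsReduced M.X] [IsDominant M.gen]

variable {J : Submodule R K} (hJ : J ≠ ⊥) {f : K} (hf : f ∈ J) (hf0 : f ≠ 0)
  (hUJ : ∀ j ∈ J, f⁻¹ * j ∈ Set.range (M.toK U hU))

/-- The comorphism of the morphism from `U` to the chart `D₊(f X)`. -/
def chartComorphism :
    HomogeneousLocalization.Away (fracReesGrading J) (reesX J hf) →+* Γ(M.X, U) :=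
  (RingEquiv.ofBijective (M.toK U hU).rangeRestrict
    ⟨fun _ _ h => M.toK_injective hU (congrArg Subtype.val h),
      (M.toK U hU).rangeRestrict_surjective⟩).symm.toRingHom.comp
    ((evalAway hf hf0).codRestrict (M.toK U hU).range
      (M.evalAway_mem_range hU hf hf0 hUJ))

lemma toK_chartComorphism (z) :
    M.toK U hU (M.chartComorphism hU hf hf0 hUJ z) = evalAway hf hf0 z :=
  congrArg Subtype.val (RingEquiv.apply_symm_apply (RingEquiv.ofBijective
    (M.toK U hU).rangeRestrict ⟨fun _ _ h => M.toK_injective hU (congrArg Subtype.val h),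
      (M.toK U hU).rangeRestrict_surjective⟩) _)

/-- The morphism to the blowup along `J` from an open subset `U` of a model on which `f⁻¹ J`
consists of regular functions. -/
def chartHom : U.toScheme ⟶ fracBlowup J :=
  U.toSpecΓ ≫ Spec.map (CommRingCat.ofHom (M.chartComorphism hU hf hf0 hUJ)) ≫ reesChartι hf

lemma genOpens_chartHom :
    M.genOpens hU ≫ M.chartHom hU hf hf0 hUJ = fracBlowupGen J hJ := by
  rw [chartHom, ← Category.assoc, genOpens_toSpecΓ, ← Spec.map_comp_assoc,
    fracBlowupGen_eq hf hf0 hJ]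
  congr 2
  ext z
  exact M.toK_chartComorphism hU hf hf0 hUJ z

include hJ in
lemma chartHom_map : M.chartHom hU hf hf0 hUJ ≫ fracBlowupMap J = U.ι ≫ M.str := by
  refine ext_of_isDominant (ι := M.genOpens hU) ?_
  rw [← Category.assoc, M.genOpens_chartHom hU hJ, fracBlowupGen_map, ← Category.assoc,
    genOpens_ι, M.gen_str]

include hJ in
/-- The local morphisms to the blowup agree on overlaps. -/
lemma comp_chartHom_eq {U' : M.X.Opens} (hU' : ⊤ ≤ M.gen ⁻¹ᵁ U') {f' : K} (hf' : f' ∈ J)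
    (hf0' : f' ≠ 0) (hUJ' : ∀ j ∈ J, f'⁻¹ * j ∈ Set.range (M.toK U' hU')) {Z : Scheme.{u}}
    (p : Z ⟶ M.X) [IsOpenImmersion p] (a : Z ⟶ U) (b : Z ⟶ U') (ha : a ≫ U.ι = p)
    (hb : b ≫ U'.ι = p)
    (g : Spec (CommRingCat.of K) ⟶ Z) (hga : g ≫ a = M.genOpens hU)
    (hgb : g ≫ b = M.genOpens hU') :
    a ≫ M.chartHom hU hf hf0 hUJ = b ≫ M.chartHom hU' hf' hf0' hUJ' := by
  have : IsReduced Z := isReduced_of_isOpenImmersion p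
  have hg : IsDominant g := M.isDominant_of_isDominant_comp_ι p g (by
    rw [← ha, ← Category.assoc, hga, genOpens_ι])
  refine ext_of_isDominant_of_isSeparated (fracBlowupMap J) ?_ g ?_
  · rw [Category.assoc, Category.assoc, M.chartHom_map hU hJ, M.chartHom_map hU' hJ,
      ← Category.assoc, ha, ← Category.assoc, hb]
  · rw [← Category.assoc, hga, ← Category.assoc, hgb, M.genOpens_chartHom hU hJ,
      M.genOpens_chartHom hU' hJ]

end Opens

variable [IsReduced M.X] [IsDominant M.gen] {J : Submodule R K} (hJ : J ≠ ⊥)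

/-- The universal property of the blowup: a model maps to the blowup along `J` as soon as `J`
becomes locally principal on it. -/
lemma exists_hom_fracBlowup
    (h : ∀ x : M.X, ∃ (U : M.X.Opens) (_ : x ∈ U) (hU : ⊤ ≤ M.gen ⁻¹ᵁ U) (f : K) (_ : f ∈ J),
      f ≠ 0 ∧ ∀ j ∈ J, f⁻¹ * j ∈ Set.range (M.toK U hU)) :
    ∃ φ : M.X ⟶ fracBlowup J, φ ≫ fracBlowupMap J = M.str ∧ M.gen ≫ φ = fracBlowupGen J hJ := by
  choose U hxU hU f hf hf0 hUJ using h
  let 𝒰 := M.X.openCoverOfIsOpenCover U (by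
    refine top_le_iff.mp fun x _ => ?_
    exact TopologicalSpace.Opens.mem_iSup.mpr ⟨x, hxU x⟩)
  let φ := 𝒰.glueMorphisms (fun x => M.chartHom (hU x) (hf x) (hf0 x) (hUJ x)) (by
    intro x y
    exact M.comp_chartHom_eq (hU x) hJ (hf x) (hf0 x) (hUJ x) (hU y) (hf y) (hf0 y) (hUJ y)
      (Limits.pullback.fst (𝒰.f x) (𝒰.f y) ≫ 𝒰.f x)
      (Limits.pullback.fst (𝒰.f x) (𝒰.f y)) (Limits.pullback.snd (𝒰.f x) (𝒰.f y))
      rfl Limits.pullback.condition.symm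
      (Limits.pullback.lift (M.genOpens (hU x)) (M.genOpens (hU y))
        ((M.genOpens_ι (hU x)).trans (M.genOpens_ι (hU y)).symm))
      (Limits.pullback.lift_fst _ _ _) (Limits.pullback.lift_snd _ _ _))
  have hφ : ∀ x, (U x).ι ≫ φ = M.chartHom (hU x) (hf x) (hf0 x) (hUJ x) := fun x =>
    𝒰.ι_glueMorphisms _ _ x
  refine ⟨φ, 𝒰.hom_ext _ _ fun x => ?_, ?_⟩
  · exact ((Category.assoc _ _ _).symm.trans (congrArg (· ≫ fracBlowupMap J) (hφ x))).trans
      (M.chartHom_map (hU x) hJ (hf x) (hf0 x) (hUJ x))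
  · have x : M.X := M.gen (⊥ : PrimeSpectrum K)
    rw [← M.genOpens_ι (hU x), Category.assoc, hφ, M.genOpens_chartHom (hU x) hJ]

end GenericModel

/-! ### Nonsingular foliations on models -/

lemma Submodule.isUnit_span_coe {R A K : Type*} [CommRing R] [CommRing A] [Field K] [Algebra R K]
    [Algebra A K] {T : Submodule R K} (h : IsUnit T) (hRA : ∀ a : R, ∃ b : A,
      algebraMap A K b = algebraMap R K a) : IsUnit (Submodule.span A (T : Set K)) := by
  obtain ⟨T', hT'⟩ := h.exists_right_inv
  refine IsUnit.of_mul_eq_one (Submodule.span A (T' : Set K)) ?_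
  rw [← Submodule.span_coe_mul, hT']
  refine le_antisymm (Submodule.span_le.mpr ?_) ?_
  · rintro x hx
    obtain ⟨a, rfl⟩ := Submodule.mem_one.mp hx
    obtain ⟨b, hb⟩ := hRA a
    exact Submodule.mem_one.mpr ⟨b, hb⟩
  · rw [Submodule.one_le]
    exact Submodule.subset_span (Submodule.one_le.mp le_rfl)

namespace GenericModel

variable {k : Type v} {R K : Type u} [Field k] [Field K] [Algebra k K] [CommRing R] [Algebra R K]
  [Algebra k R] [IsScalarTower k R K] (M : GenericModel R K)

lemma sections_mono {U V : M.X.Opens} (hVU : V ≤ U) (hV : ⊤ ≤ M.gen ⁻¹ᵁ V)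
    (hU : ⊤ ≤ M.gen ⁻¹ᵁ U) : M.sections k U hU ≤ M.sections k V hV := by
  rintro _ ⟨s, rfl⟩
  exact ⟨_, M.toK_res hVU hV hU s⟩

section BasicOpen

variable {U : M.X.Opens} (hU : ⊤ ≤ M.gen ⁻¹ᵁ U) (s : Γ(M.X, U))
  (hD : ⊤ ≤ M.gen ⁻¹ᵁ M.X.basicOpen s)

include hD in
lemma toK_ne_zero : M.toK U hU s ≠ 0 := fun h => (M.toK_eq_zero_iff hU s).mp h hD

lemma inv_toK_mem_sections_basicOpen :
    (M.toK U hU s)⁻¹ ∈ M.sections k (M.X.basicOpen s) hD := by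
  obtain ⟨t, ht⟩ := (M.X.toRingedSpace.isUnit_res_basicOpen s).exists_right_inv
  have h := congrArg (M.toK _ hD) ht
  have h' : M.toK _ hD ((M.X.presheaf.map (homOfLE (M.X.basicOpen_le s)).op).hom s) *
    M.toK _ hD t = 1 :=
    (map_mul (M.toK _ hD) _ _).symm.trans (h.trans (map_one _))
  rw [M.toK_res _ hD hU] at h'
  exact ⟨t, eq_inv_of_mul_eq_one_right h'⟩

lemma exists_pow_toK_mul_mem_sections (ha : IsAffineOpen U) {x : K}
    (hx : x ∈ M.sections k (M.X.basicOpen s) hD) :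
    ∃ n : ℕ, M.toK U hU s ^ n * x ∈ M.sections k U hU := by
  obtain ⟨t, rfl⟩ := hx
  have := ha.isLocalization_basicOpen s
  obtain ⟨n, a, h⟩ := IsLocalization.Away.surj s t
  refine ⟨n, a, ?_⟩
  have h' := congrArg (M.toK _ hD) h
  rw [map_mul, map_pow] at h'
  have e (b : Γ(M.X, U)) : M.toK _ hD (algebraMap Γ(M.X, U) Γ(M.X, M.X.basicOpen s) b) =
    M.toK U hU b := M.toK_res (M.X.basicOpen_le s) hD hU b
  rw [e, e] at h'
  rw [← h', mul_comm]

end BasicOpen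

variable (L : SingularFoliation k K) {r : ℕ}
  (δ : Module.Basis (Fin r) K L.space)

/-- Invertibility of `𝒥(𝒪)` passes from an affine open subset to its basic open subsets. -/
lemma isUnit_jac_one_basicOpen {U : M.X.Opens} (hU : ⊤ ≤ M.gen ⁻¹ᵁ U) (ha : IsAffineOpen U)
    (s : Γ(M.X, U)) (hD : ⊤ ≤ M.gen ⁻¹ᵁ M.X.basicOpen s)
    (h : IsUnit (L.jac δ (1 : Submodule (M.sections k U hU) K))) :
    IsUnit (L.jac δ (1 : Submodule (M.sections k (M.X.basicOpen s) hD) K)) := by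
  have hle := M.sections_mono (k := k) (M.X.basicOpen_le s) hD hU
  rw [L.jac_one_of_isLocalized δ hle (M.toK_ne_zero hU s hD) ⟨s, rfl⟩
    (M.inv_toK_mem_sections_basicOpen hU s hD)
    (fun x hx => M.exists_pow_toK_mul_mem_sections hU s hD ha hx)]
  exact Submodule.isUnit_span_coe h fun a => ⟨⟨a, hle a.2⟩, rfl⟩

/-- Invertibility of `𝒥(𝒪)` is a local property. -/
lemma isUnit_jac_one_of_forall_exists [IsDominant M.gen] {U : M.X.Opens}
    (hU : ⊤ ≤ M.gen ⁻¹ᵁ U) (ha : IsAffineOpen U)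
    (h : ∀ x ∈ U, ∃ (V : M.X.Opens) (hV : ⊤ ≤ M.gen ⁻¹ᵁ V), IsAffineOpen V ∧ x ∈ V ∧
      IsUnit (L.jac δ (1 : Submodule (M.sections k V hV) K))) :
    IsUnit (L.jac δ (1 : Submodule (M.sections k U hU) K)) := by
  have h1 : ∀ x : U, ∃ s : Γ(M.X, U), (x : M.X) ∈ M.X.basicOpen s ∧
      ∃ hD : ⊤ ≤ M.gen ⁻¹ᵁ M.X.basicOpen s,
        IsUnit (L.jac δ (1 : Submodule (M.sections k (M.X.basicOpen s) hD) K)) := by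
    rintro ⟨x, hx⟩
    obtain ⟨V, hV, hVa, hxV, hu⟩ := h x hx
    obtain ⟨s, t, hst, hxs⟩ := exists_basicOpen_le_affine_inter ha hVa x ⟨hx, hxV⟩
    have hD : ⊤ ≤ M.gen ⁻¹ᵁ M.X.basicOpen s := M.le_preimage_gen fun hb => by
      rw [hb] at hxs
      exact hxs
    refine ⟨s, hxs, hD, ?_⟩
    have key (W : M.X.Opens) (hW : W = M.X.basicOpen t) (hWg : ⊤ ≤ M.gen ⁻¹ᵁ W) :
        IsUnit (L.jac δ (1 : Submodule (M.sections k W hWg) K)) := by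
      subst hW
      exact M.isUnit_jac_one_basicOpen L δ hV hVa t hWg hu
    exact key _ hst hD
  choose s hxs hD hu using h1
  have hspan : Ideal.span (Set.range s) = ⊤ := by
    rw [← ha.iSup_basicOpen_eq_self_iff]
    refine le_antisymm (iSup_le fun f => M.X.basicOpen_le _) fun x hx => ?_
    exact TopologicalSpace.Opens.mem_iSup.mpr ⟨⟨s ⟨x, hx⟩, ⟨x, hx⟩, rfl⟩, hxs ⟨x, hx⟩⟩
  refine L.isUnit_jac_one_of_local δ (S := M.toSections k U hU '' Set.range s) ?_ ?_
  · rw [← Ideal.map_span, hspan, Ideal.map_top]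
  · rintro _ ⟨_, ⟨x, rfl⟩, rfl⟩
    exact ⟨M.toK_ne_zero hU _ (hD x), M.sections k _ (hD x),
      M.sections_mono (M.X.basicOpen_le _) _ _, M.inv_toK_mem_sections_basicOpen hU _ (hD x),
      fun y hy => M.exists_pow_toK_mul_mem_sections hU _ (hD x) ha hy, hu x⟩

end GenericModel

section Nonsingular

variable {k : Type v} {R K : Type u} [Field k] [Field K] [Algebra k K] [CommRing R] [Algebra R K]
  [Algebra k R] [IsScalarTower k R K] {J : Submodule R K}

lemma isBlowupChart_sections (hJ : J ≠ ⊥) {f : K} (hf : f ∈ J) (hf0 : f ≠ 0)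
    (h : ⊤ ≤ (blowupModel J hJ).gen ⁻¹ᵁ reesChart hf) :
    IsBlowupChart ((blowupModel J hJ).sections k (reesChart hf) h) J f :=
  fun x => mem_sections_reesChart hJ hf hf0 h x

variable [CharZero k] (L : SingularFoliation k K) {r : ℕ} (δ : Module.Basis (Fin r) K L.space)

omit [IsScalarTower k R K] in
lemma SingularFoliation.jac_pow_le (J : Submodule R K) :
    L.jac δ J ^ (r + 2) ≤ L.jac δ (J * L.jac δ J) := by
  rw [pow_succ, mul_comm J]
  exact L.pow_mul_jac_le δ (L.jac δ J) J

/-- If the foliation is nonsingular on the blowup along `J` then `𝒥(J)^(r+2)` and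
`𝒥(J 𝒥(J))` agree on all charts, hence after multiplication by a power of `J`. -/
lemma SingularFoliation.exists_pow_mul_jac_pow_eq [IsDomain R] [IsFractionRing R K]
    [Algebra.FiniteType k R] (hJ : J ≠ ⊥) (hfg : J.FG)
    (h : L.IsNonsingularOn (blowupModel J hJ)) :
    ∃ N : ℕ, J ^ N * L.jac δ J ^ (r + 2) = J ^ N * L.jac δ (J * L.jac δ J) := by
  obtain ⟨N, hN⟩ := Submodule.exists_pow_mul_le_of_local (P := L.jac δ J ^ (r + 2)) hfg
    (L.jac_fg δ (hfg.mul (L.jac_fg δ hfg))) fun f hf hf0 x hx => by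
      have hU := le_preimage_gen_reesChart hJ hf hf0
      have hA := isBlowupChart_sections (k := k) hJ hf hf0 hU
      have := h _ (isAffineOpen_reesChart hf) hU
      have := hA.isFractionRing hf hf0
      exact hA.exists_pow_mul_mem L δ hf hf0 (L.isUnit_jac_of_projective δ) hx
  exact ⟨N, le_antisymm (mul_le_mul' le_rfl (L.jac_pow_le δ J)) hN⟩

/-- The charts `D₊(f h X)`, for `f ∈ J` and `h ∈ I`, cover the blowup along `J I`. -/
lemma exists_mem_reesChart_mul {I : Submodule R K} (x : fracBlowup (J * I)) :
    ∃ (f h : K) (hf : f ∈ J) (hh : h ∈ I), f ≠ 0 ∧ h ≠ 0 ∧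
      x ∈ reesChart (Submodule.mul_mem_mul hf hh) := by
  let G : Set K := Set.image2 (· * ·) J I
  have hGJ : G ⊆ (J * I : Submodule R K) := by
    rintro _ ⟨f, hf, h, hh, rfl⟩
    exact Submodule.mul_mem_mul hf hh
  obtain ⟨_, ⟨f, hf, h, hh, rfl⟩, h0, hx⟩ := exists_mem_reesChart hGJ
    (fun _ hy => (Submodule.mul_eq_span_mul_set J I).le hy) x
  exact ⟨f, h, hf, hh, left_ne_zero_of_mul h0, right_ne_zero_of_mul h0, hx⟩

lemma SingularFoliation.isNonsingularOn_blowupModel {N : ℕ}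
    (heq : J ^ N * L.jac δ J ^ (r + 2) = J ^ N * L.jac δ (J * L.jac δ J))
    (h0 : J * L.jac δ J ≠ ⊥) : L.IsNonsingularOn (blowupModel (J * L.jac δ J) h0) := by
  intro U ha hU
  refine L.projective_reducedDifferentials δ
    ((blowupModel (J * L.jac δ J) h0).isUnit_jac_one_of_forall_exists L δ hU ha fun x _ => ?_)
  obtain ⟨f, h, hf, hh, hf0, hh0, hx⟩ := exists_mem_reesChart_mul x
  have hfh := Submodule.mul_mem_mul hf hh
  have hV := le_preimage_gen_reesChart h0 hfh (mul_ne_zero hf0 hh0)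
  exact ⟨reesChart hfh, hV, isAffineOpen_reesChart hfh, hx,
    (isBlowupChart_sections h0 hfh (mul_ne_zero hf0 hh0) hV).isUnit_jac_one L δ hf hf0 hh hh0 heq⟩

end Nonsingular

/-! ### Iterated blowups -/

namespace GenericModel

variable {k : Type v} {R K : Type u} [Field k] [Field K] [Algebra k K] [CommRing R] [Algebra R K]
  [Algebra k R] [IsScalarTower k R K] (M : GenericModel R K)

lemma specMap_algebraMap_toSections {U : M.X.Opens} (hU : ⊤ ≤ M.gen ⁻¹ᵁ U) :
    Spec.map (CommRingCat.ofHom (algebraMap (M.sections k U hU) K)) ≫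
      Spec.map (CommRingCat.ofHom (M.toSections k U hU)) =
        Spec.map (CommRingCat.ofHom (M.toK U hU)) := by
  rw [← Spec.map_comp]
  rfl

instance [IsReduced M.X] [IsDominant M.gen] {U : M.X.Opens} (hU : ⊤ ≤ M.gen ⁻¹ᵁ U) :
    IsIso (CommRingCat.ofHom (M.toSections k U hU)) := by
  rw [ConcreteCategory.isIso_iff_bijective]
  refine ⟨fun _ _ h => M.toK_injective hU (congrArg Subtype.val h), ?_⟩
  rintro ⟨_, s, rfl⟩
  exact ⟨s, rfl⟩

section OpenBlowup

variable {U : M.X.Opens} (hU : ⊤ ≤ M.gen ⁻¹ᵁ U) (ha : IsAffineOpen U)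
  {T : Submodule (M.sections k U hU) K} (hT : T ≠ ⊥)

/-- The blowup of an affine open subset `U` of a model along a `Γ(U)`-submodule of `K`, as a model
over the original base. -/
def openBlowup : GenericModel R K where
  X := fracBlowup T
  str := (fracBlowupMap T ≫ Spec.map (CommRingCat.ofHom (M.toSections k U hU))) ≫
    ha.fromSpec ≫ M.str
  gen := fracBlowupGen T hT
  gen_str := by
    rw [Category.assoc, ← Category.assoc, fracBlowupGen_map,
      reassoc_of% M.specMap_algebraMap_toSections hU, ← Category.assoc, ← M.gen_eq hU ha, M.gen_str]

lemma openBlowup_gen_map :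
    fracBlowupGen T hT ≫ (fracBlowupMap T ≫ Spec.map (CommRingCat.ofHom (M.toSections k U hU))) ≫
      ha.fromSpec = M.gen := by
  rw [Category.assoc, ← Category.assoc, fracBlowupGen_map,
    reassoc_of% M.specMap_algebraMap_toSections hU, ← M.gen_eq hU ha]

instance : IsReduced (M.openBlowup hU ha hT).X := inferInstanceAs (IsReduced (fracBlowup T))

instance : IsDominant (M.openBlowup hU ha hT).gen :=
  inferInstanceAs (IsDominant (blowupModel T hT).gen)

variable {J I : Submodule R K} (hJI : J * I ≠ ⊥) {f a : K} (hf : f ∈ J) (hf0 : f ≠ 0)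
  (hfJ : ∀ j ∈ J, f⁻¹ * j ∈ M.sections k U hU)
  (hTI : Submodule.span (M.sections k U hU) ((a⁻¹ * ·) '' (I : Set K)) = T)

include hJI hf hf0 hfJ hTI in
/-- If `f⁻¹ J` consists of regular functions on `U` and `T` is generated by a multiple of `I`, then
`J I` is locally principal on the blowup of `U` along `T`. -/
lemma exists_openBlowup_hom :
    ∃ j : fracBlowup T ⟶ fracBlowup (J * I),
      j ≫ fracBlowupMap (J * I) =
          (fracBlowupMap T ≫ Spec.map (CommRingCat.ofHom (M.toSections k U hU))) ≫
            ha.fromSpec ≫ M.str ∧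
        fracBlowupGen T hT ≫ j = fracBlowupGen (J * I) hJI := by
  refine (M.openBlowup hU ha hT).exists_hom_fracBlowup hJI fun x => ?_
  have hGT : (a⁻¹ * ·) '' (I : Set K) ⊆ T := fun y hy => hTI ▸ Submodule.subset_span hy
  obtain ⟨_, ⟨h, hh, rfl⟩, ht0, hx⟩ := exists_mem_reesChart hGT (fun y hy => hTI.ge hy) x
  have ht := hGT ⟨h, hh, rfl⟩
  have hh0 : h ≠ 0 := right_ne_zero_of_mul ht0
  have hV := le_preimage_gen_reesChart hT ht ht0
  refine ⟨reesChart ht, hx, hV, f * h, Submodule.mul_mem_mul hf hh, mul_ne_zero hf0 hh0, ?_⟩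
  change ∀ y ∈ J * I, (f * h)⁻¹ * y ∈ ((blowupModel T hT).toK (reesChart ht) hV).range
  intro y hy
  induction hy using Submodule.mul_induction_on' with
  | mem_mul_mem j hj i hi =>
    have h1 : f⁻¹ * j ∈ ((blowupModel T hT).toK (reesChart ht) hV).range :=
      (blowupModel T hT).toK_str _ hV ⟨_, hfJ j hj⟩
    have h2 : h⁻¹ * i ∈ ((blowupModel T hT).toK (reesChart ht) hV).range := by
      refine (mem_sections_reesChart hT ht ht0 hV _).mpr ⟨1, ?_⟩
      rw [pow_one, pow_one, mul_assoc, mul_inv_cancel_left₀ hh0]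
      exact hGT ⟨i, hi, rfl⟩
    convert mul_mem h1 h2 using 1
    rw [mul_inv]
    ring
  | add y _ z _ hy hz =>
    rw [mul_add]
    exact add_mem hy hz

variable [IsReduced M.X] [IsDominant M.gen] [IsSeparated M.str]

include hT hJI hf hf0 hfJ hTI in
/-- Let `U` be an affine open subset of a model over which `J` is generated by `f`. Then the blowup
along `J I` is, over `U`, the blowup along the module generated by `I`. Both sides of the
comparison come from the universal property of the blowup. -/
lemma exists_isPullback_openBlowup (ha0 : a ≠ 0) {π : fracBlowup (J * I) ⟶ M.X}
    (hπ : π ≫ M.str = fracBlowupMap (J * I))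
    (hgen : fracBlowupGen (J * I) hJI ≫ π = M.gen) :
    ∃ j : fracBlowup T ⟶ fracBlowup (J * I), IsPullback j
      (fracBlowupMap T ≫ Spec.map (CommRingCat.ofHom (M.toSections k U hU))) π ha.fromSpec := by
  obtain ⟨j, hj, hjgen⟩ := M.exists_openBlowup_hom hU ha hT hJI hf hf0 hfJ hTI
  have : IsDominant (fracBlowupGen T hT) := inferInstanceAs (IsDominant (blowupModel T hT).gen)
  let τ := CommRingCat.ofHom (M.toSections k U hU)
  let q := fracBlowupMap T ≫ Spec.map τ
  have comm : j ≫ π = q ≫ ha.fromSpec := by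
    refine ext_of_isDominant_of_isSeparated M.str ?_ (fracBlowupGen T hT) ?_
    · rw [Category.assoc, hπ, hj]
      exact (Category.assoc q ha.fromSpec M.str).symm
    · rw [← Category.assoc, hjgen, hgen]
      exact (M.openBlowup_gen_map hU ha hT).symm
  let P := Limits.pullback π ha.fromSpec
  let p₁ : P ⟶ fracBlowup (J * I) := Limits.pullback.fst _ _
  let p₂ : P ⟶ Spec _ := Limits.pullback.snd _ _
  have hp : p₁ ≫ π = p₂ ≫ ha.fromSpec := Limits.pullback.condition
  let g : Spec (CommRingCat.of K) ⟶ P := Limits.pullback.lift (fracBlowupGen (J * I) hJI)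
    (Spec.map (CommRingCat.ofHom (M.toK U hU))) (hgen.trans (M.gen_eq hU ha))
  have hg₁ : g ≫ p₁ = fracBlowupGen (J * I) hJI := Limits.pullback.lift_fst _ _ _
  have hg₂ : g ≫ p₂ = Spec.map (CommRingCat.ofHom (M.toK U hU)) := Limits.pullback.lift_snd _ _ _
  have hτ : Spec.map (inv τ) ≫ Spec.map τ = 𝟙 _ := by
    rw [← Spec.map_comp, IsIso.hom_inv_id, Spec.map_id]
  have hτ' : Spec.map τ ≫ Spec.map (inv τ) = 𝟙 _ := by
    rw [← Spec.map_comp, IsIso.inv_hom_id, Spec.map_id]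
  -- The fibre product as a model over `Γ(U)` and over `R`.
  let PA : GenericModel (M.sections k U hU) K :=
    { X := P
      str := p₂ ≫ Spec.map (inv τ)
      gen := g
      gen_str := by
        rw [← Category.assoc, hg₂, ← M.specMap_algebraMap_toSections (k := k) hU, Category.assoc]
        exact congrArg (_ ≫ ·) hτ' }
  let PR : GenericModel R K :=
    { X := P
      str := p₁ ≫ fracBlowupMap (J * I)
      gen := g
      gen_str := by rw [← Category.assoc, hg₁, fracBlowupGen_map] }
  have : IsOpenImmersion p₁ := inferInstanceAs (IsOpenImmersion (Limits.pullback.fst _ _))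
  have : IsReduced P := isReduced_of_isOpenImmersion p₁
  have : IsReduced PA.X := ‹_›
  have : IsReduced PR.X := ‹_›
  have : IsDominant (g ≫ p₁) :=
    hg₁ ▸ inferInstanceAs (IsDominant (blowupModel (J * I) hJI).gen)
  have : IsDominant g := IsDominant.of_comp_of_isOpenImmersion g p₁
  have : IsDominant PA.gen := ‹_›
  have : IsDominant PR.gen := ‹_›
  obtain ⟨ψ, hψ, hψgen⟩ : ∃ ψ : P ⟶ fracBlowup T,
      ψ ≫ fracBlowupMap T = p₂ ≫ Spec.map (inv τ) ∧ g ≫ ψ = fracBlowupGen T hT := by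
    refine PA.exists_hom_fracBlowup hT fun x => ?_
    obtain ⟨f', h, hf', hh, hf0', hh0, hx⟩ := exists_mem_reesChart_mul (p₁ x)
    have hfh := Submodule.mul_mem_mul hf' hh
    have hfh0 := mul_ne_zero hf0' hh0
    let V : P.Opens := p₁ ⁻¹ᵁ reesChart hfh
    have hV' := le_preimage_gen_reesChart hJI hfh hfh0
    have hV : ⊤ ≤ PR.gen ⁻¹ᵁ V := by
      intro y _
      have h1 := hV' (show y ∈ _ from trivial)
      have h2 : (blowupModel (J * I) hJI).gen y = p₁ (g y) := by
        rw [← Scheme.Hom.comp_apply, hg₁]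
        rfl
      change (blowupModel (J * I) hJI).gen y ∈ reesChart hfh at h1
      rw [h2] at h1
      exact h1
    refine ⟨V, hx, hV, a⁻¹ * h, hTI ▸ Submodule.subset_span ⟨h, hh, rfl⟩,
      mul_ne_zero (inv_ne_zero ha0) hh0, fun y hy => ?_⟩
    change _ ∈ (PA.toK V hV).range
    rw [← hTI] at hy
    induction hy using Submodule.span_induction with
    | mem y hy =>
      obtain ⟨i, hi, rfl⟩ := hy
      obtain ⟨s, hs⟩ := (mem_sections_reesChart hJI hfh hfh0 hV' (h⁻¹ * i)).mpr ⟨1, by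
        rw [pow_one, pow_one, mul_assoc, mul_inv_cancel_left₀ hh0]
        exact Submodule.mul_mem_mul hf' hi⟩
      refine ⟨_, (toK_appLE (M := PR) (N := blowupModel (J * I) hJI) p₁ hg₁ (V := V) le_rfl hV hV'
        s).trans (hs.trans ?_)⟩
      rw [mul_inv, inv_inv]
      field_simp
    | zero => simp
    | add y z _ _ hy hz =>
      rw [mul_add]
      exact add_mem hy hz
    | smul c y _ hy =>
      rw [Algebra.smul_def, mul_left_comm]
      exact mul_mem (PA.toK_str V hV c) hy
  let j' : fracBlowup T ⟶ P := Limits.pullback.lift j q comm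
  have hj₁ : j' ≫ p₁ = j := Limits.pullback.lift_fst _ _ _
  have hj₂ : j' ≫ p₂ = q := Limits.pullback.lift_snd _ _ _
  have hgj : fracBlowupGen T hT ≫ j' = g := by
    rw [← cancel_mono p₁, Category.assoc, hj₁, hg₁]
    exact hjgen
  have e₁ : j' ≫ ψ = 𝟙 _ := by
    refine ext_of_isDominant_of_isSeparated (fracBlowupMap T) ?_ (fracBlowupGen T hT) ?_
    · rw [Category.assoc, hψ, ← Category.assoc, hj₂, Category.id_comp, Category.assoc]
      exact (congrArg (_ ≫ ·) hτ').trans (Category.comp_id _)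
    · rw [← Category.assoc, hgj, hψgen, Category.comp_id]
  have e₂ : ψ ≫ j' = 𝟙 _ := by
    rw [← cancel_mono p₁, Category.assoc, hj₁, Category.id_comp]
    refine ext_of_isDominant_of_isSeparated (fracBlowupMap (J * I)) ?_ g ?_
    · rw [Category.assoc, hj]
      rw [Category.assoc, ← Category.assoc, hψ, Category.assoc, ← Category.assoc (Spec.map (inv τ)),
        hτ, Category.id_comp, ← Category.assoc, ← hp, Category.assoc, hπ]
    · rw [← Category.assoc, hψgen, hg₁, hjgen]
  exact ⟨j, IsPullback.of_iso_pullback ⟨comm⟩ ⟨j', ψ, e₁, e₂⟩ hj₁ hj₂⟩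

end OpenBlowup

end GenericModel

/-! ### The Gauss blowup -/

section Gauss

variable {k : Type v} {R K : Type u} [Field k] [CharZero k] [Field K] [Algebra k K] [CommRing R]
  [Algebra R K] {J : Submodule R K}
  (L : SingularFoliation k K) {r : ℕ} (δ : Module.Basis (Fin r) K L.space)

/-- On the chart `A = R[f⁻¹ J]` the module defining the Gauss blowup is generated by
`f^(-r-1) 𝒥(J)`. -/
lemma SingularFoliation.span_image_eq_topReducedDifferentials {A : Subalgebra k K} {f : K}
    (hA : IsBlowupChart A J f) (hf : f ∈ J) (hf0 : f ≠ 0) :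
    Submodule.span A (((f ^ (r + 1))⁻¹ * ·) '' (L.jac δ J : Set K)) =
      L.topReducedDifferentials δ A := by
  have h := Submodule.map_span (LinearMap.mulLeft A (f ^ (r + 1))⁻¹) (L.jac δ J : Set K)
  have h' : Submodule.span A (((f ^ (r + 1))⁻¹ * ·) '' (L.jac δ J : Set K)) = _ := h.symm
  have hfr : f ^ (r + 1) ≠ 0 := pow_ne_zero _ hf0
  rw [h', L.topReducedDifferentials_eq_jac, hA.span_jac L δ hf hf0, Submodule.span_pow,
    Set.singleton_pow]
  ext x
  rw [Submodule.mem_map]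
  constructor
  · rintro ⟨y, hy, rfl⟩
    obtain ⟨z, hz, rfl⟩ := Submodule.mem_span_singleton_mul.mp hy
    rwa [LinearMap.mulLeft_apply, inv_mul_cancel_left₀ hfr]
  · intro hx
    exact ⟨f ^ (r + 1) * x, Submodule.mem_span_singleton_mul.mpr ⟨x, hx, rfl⟩,
      inv_mul_cancel_left₀ hfr x⟩

/-- The blowup along `J 𝒥(J)` is the Gauss blowup of the blowup along `J`, whether or not the
foliation becomes nonsingular. -/
lemma SingularFoliation.exists_isGaussBlowup [Algebra k R] [IsScalarTower k R K] (hJ : J ≠ ⊥)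
    (h0 : J * L.jac δ J ≠ ⊥) :
    ∃ π, L.IsGaussBlowup δ (blowupModel J hJ) (blowupModel (J * L.jac δ J) h0) π := by
  obtain ⟨π, hπ, hgen⟩ := (blowupModel (J * L.jac δ J) h0).exists_hom_fracBlowup hJ fun x => by
    obtain ⟨f, h, hf, hh, hf0, hh0, hx⟩ := exists_mem_reesChart_mul x
    have hfh := Submodule.mul_mem_mul hf hh
    have hV := le_preimage_gen_reesChart h0 hfh (mul_ne_zero hf0 hh0)
    refine ⟨reesChart hfh, hx, hV, f, hf, hf0, fun j hj => ?_⟩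
    refine (mem_sections_reesChart h0 hfh (mul_ne_zero hf0 hh0) hV _).mpr ⟨1, ?_⟩
    rw [pow_one, pow_one, mul_right_comm, mul_inv_cancel_left₀ hf0]
    exact Submodule.mul_mem_mul hj hh
  refine ⟨π, hπ, hgen, fun x => ?_⟩
  obtain ⟨f, hf, hf0, hx⟩ := exists_mem_reesChart (J := J) (G := (J : Set K)) subset_rfl
    Submodule.subset_span x
  have hU := le_preimage_gen_reesChart hJ hf hf0
  have hA := isBlowupChart_sections (k := k) hJ hf hf0 hU
  have hT := L.span_image_eq_topReducedDifferentials δ hA hf hf0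
  have hT0 : L.topReducedDifferentials δ ((blowupModel J hJ).sections k _ hU) ≠ ⊥ := by
    obtain ⟨y, hy, hy0⟩ := Submodule.exists_mem_ne_zero_of_ne_bot
      (right_ne_zero_of_mul (a := J) (b := L.jac δ J) h0)
    rw [← hT]
    intro h
    have : (f ^ (r + 1))⁻¹ * y ∈ (⊥ : Submodule ((blowupModel J hJ).sections k _ hU) K) :=
      h ▸ Submodule.subset_span ⟨y, hy, rfl⟩
    exact mul_ne_zero (inv_ne_zero (pow_ne_zero _ hf0)) hy0 ((Submodule.mem_bot _).mp this)
  exact ⟨reesChart hf, hx, isAffineOpen_reesChart hf, hU,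
    (blowupModel J hJ).exists_isPullback_openBlowup hU (isAffineOpen_reesChart hf) hT0 h0 hf hf0
      (fun j hj => hA.inv_mul_mem hf0 hj) hT (pow_ne_zero _ hf0) hπ hgen⟩

end Gauss

end

theorem theorem15 {k : Type v} {R K : Type u} [Field k] [CharZero k] [CommRing R] [IsDomain R]
    [Algebra k R] [Algebra.FiniteType k R] [Field K] [Algebra R K] [IsFractionRing R K]
    [Algebra k K] [IsScalarTower k R K] (L : SingularFoliation k K) {r : ℕ}
    (δ : Module.Basis (Fin r) K L.space) :
    -- (i)
    (∀ J : FractionalIdeal (nonZeroDivisors R) K,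
      L.jac δ (J : Submodule R K) ^ (r + 2) ≤
        L.jac δ ((J : Submodule R K) * L.jac δ (J : Submodule R K))) ∧
    ∀ (J : FractionalIdeal (nonZeroDivisors R) K) (hJ : (J : Submodule R K) ≠ ⊥),
      -- (ii)
      (L.IsNonsingularOn (blowupModel (J : Submodule R K) hJ) →
        ∃ N : ℕ, (J : Submodule R K) ^ N * L.jac δ (J : Submodule R K) ^ (r + 2) =
          (J : Submodule R K) ^ N *
            L.jac δ ((J : Submodule R K) * L.jac δ (J : Submodule R K))) ∧
      -- (iii)
      ((∃ N : ℕ, (J : Submodule R K) ^ N * L.jac δ (J : Submodule R K) ^ (r + 2) =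
          (J : Submodule R K) ^ N *
            L.jac δ ((J : Submodule R K) * L.jac δ (J : Submodule R K))) →
        L.IsNonsingularOn (blowupModel ((J : Submodule R K) * L.jac δ (J : Submodule R K))
            (mul_ne_zero hJ (L.jac_ne_bot δ hJ))) ∧
          ∃ π : (blowupModel ((J : Submodule R K) * L.jac δ (J : Submodule R K))
              (mul_ne_zero hJ (L.jac_ne_bot δ hJ))).X ⟶ (blowupModel (J : Submodule R K) hJ).X,
            L.IsGaussBlowup δ (blowupModel (J : Submodule R K) hJ)
              (blowupModel ((J : Submodule R K) * L.jac δ (J : Submodule R K))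
                (mul_ne_zero hJ (L.jac_ne_bot δ hJ))) π) := by
  refine ⟨fun J => L.jac_pow_le δ (J : Submodule R K), fun J hJ => ⟨fun h => ?_, ?_⟩⟩
  · have : IsNoetherianRing R := Algebra.FiniteType.isNoetherianRing k R
    have hfg : (J : Submodule R K).FG :=
      isNoetherian_submodule.mp (FractionalIdeal.isNoetherian J) _ le_rfl
    exact L.exists_pow_mul_jac_pow_eq δ hJ hfg h
  · rintro ⟨N, heq⟩
    have h0 := mul_ne_zero hJ (L.jac_ne_bot δ hJ)
    exact ⟨L.isNonsingularOn_blowupModel δ heq h0, L.exists_isGaussBlowup δ hJ h0⟩
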